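/- Let $c\in\mathbb{C}\setminus\big([-1,0)\cup(0,1]\big)$ and let $s\in\mathbb{C}$, $0<|s|\le 1$, satisfy $c=\tfrac12\left(s+\tfrac1s\right)$ (so $|s|<1$ if $c\ne 0$, and $s=\pm i$ if $c=0$). Consider Hill's equation $$g''+Q(\eta)\,g=\mu g,\qquad Q(\eta)=\frac{\sin\eta}{c+\sin\eta},\qquad \mu\in\mathbb{C},$$ where $Q\equiv 1$ if $c=0$. Put $\kappa=-\frac{1+s^2}{1-s^2}$, $g_0=1+\kappa$, $g_k=\kappa\, i^k s^{|k|}$ for $k\in\mathbb{Z}\setminus\{0\}$, and $\tilde g_0=0$, $\tilde g_k=g_k$ for $k\neq 0$. Then the following hold. 1. The numbers $g_k$ are the Fourier coefficients of $Q$, i.e. $\frac1{2\pi}\int_0^{2\pi}Q(\eta)e^{-ik\eta}\,d\eta=g_k$ for all $k\in\mathbb{Z}$, and $Q(\eta)=\sum_{k\in\mathbb{Z}}g_k e^{ik\eta}$ with absolute convergence for every $\eta\in\mathbb{R}$. 2. Let $\mu\in\mathbb{C}$ and $\Lambda=g_0-\mu$, with $\Lambda\ne n^2$ for all $n\in\mathbb{Z}$.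 Inserting $g=\sum_m a_m e^{im\eta}$ into Hill's equation gives the linear system $-n^2a_n+\sum_m g_{n-m}a_m-\mu a_n=0$ ($n\in\mathbb{Z}$). Dividing each equation by its diagonal coefficient gives the matrix $$\left(\frac{\tilde g_{n-m}}{\Lambda-n^2}+\delta_{n,m}\right)_{n,m\in\mathbb{Z}}.$$ The entries of the difference between this matrix and the identity are absolutely summable, and the determinants of the truncations to $-N\le n,m\le N$ converge as $N\to\infty$. Their limit is the Hill determinant of the equation, $$D(\Lambda)=\det\left(\frac{\tilde g_{n-m}}{\Lambda-n^2}+\delta_{n,m}\right)_{n,m\in\mathbb{Z}}.$$ The truncation with $N=1$ has determinant $$\det\begin{pmatrix}1&-\frac{i\kappa s}{\Lambda}&-\frac{\kappa s^2}{\Lambda-1}\\ \frac{i\kappa s}{\Lambda-1}&1&-\frac{i\kappa s}{\Lambda-1}\\ -\frac{\kappa s^2}{\Lambda-1}&\frac{i\kappa s}{\Lambda}&1\end{pmatrix}.$$ 3. For every $\mu\in\mathbb{C}$ the equation, written as a first order system for $(g,g')$, has a unique principal fundamental matrix $M$ on $\mathbb{R}$, normalised by $M(0)=I$. Let $\Delta(\mu)=\operatorname{tr}M(2\pi)$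 be Hill's discriminant. If $g_0-\mu\neq n^2$ for all $n\in\mathbb{Z}$, then $$\Delta(\mu)=2-4\,D(g_0-\mu)\,\sin^2\!\big(\pi\sqrt{g_0-\mu}\big),$$ which does not depend on the choice of the square root. At the remaining values of $\mu$, where $D(g_0-\mu)$ is undefined, the right-hand side has a removable singularity, and the formula holds by continuous extension: $\Delta(\mu)$ is the limit of the right-hand side at $\nu$ as $\nu\to\mu$, $\nu\ne\mu$. -/

import Mathlib

/-- The potential `Q(η) = sin η / (c + sin η)` with complex parameter `c`.  For `c = 0` the quotient
is `0 / 0` at the zeros of the sine; there `Q` denotes its continuous extension, the constant `1`. -/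
noncomputable def hillPotential (c : ℂ) (η : ℝ) : ℂ :=
  if c = 0 then 1 else (Real.sin η : ℂ) / (c + (Real.sin η : ℂ))

/-- The complex Fourier coefficient `(1 / 2π) ∫₀^{2π} Q(η) e^{-ikη} dη` of a `2π`-periodic
function. -/
noncomputable def hillFourier (Q : ℝ → ℂ) (k : ℤ) : ℂ :=
  fourierCoeffOn Real.two_pi_pos Q k

/-- Coefficient matrix of the first order system `(g, g')' = A(η) (g, g')` that is equivalent to
Hill's equation `g'' + Q(η) g = μ g`. -/
noncomputable def hillSystemMatrix (Q : ℝ → ℂ) (μ : ℂ) (η : ℝ) : Matrix (Fin 2) (Fin 2) ℂ :=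
  !![0, 1; μ - Q η, 0]

/-- `M` is the principal fundamental solution matrix of `g'' + Q(η) g = μ g`, that is,
`M' = A M` on the whole line, and `M(0)` is the identity matrix. -/
def IsPrincipalFundamentalMatrix (Q : ℝ → ℂ) (μ : ℂ) (M : ℝ → Matrix (Fin 2) (Fin 2) ℂ) : Prop :=
  M 0 = 1 ∧ ∀ (η : ℝ) (i j : Fin 2),
    HasDerivAt (fun t : ℝ => M t i j) ((hillSystemMatrix Q μ η * M η) i j) η

open Classical in
/-- Hill's discriminant `Δ(μ)`: the trace of the monodromy matrix `M(2π)`, where `M` is the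
principal fundamental solution matrix (value `0` if there is none). -/
noncomputable def hillDiscriminant (Q : ℝ → ℂ) (μ : ℂ) : ℂ :=
  if h : ∃ M : ℝ → Matrix (Fin 2) (Fin 2) ℂ, IsPrincipalFundamentalMatrix Q μ M then
    (h.choose (2 * Real.pi)).trace
  else 0

/-- The determinant of the central truncation `(a_{n,m})`, `-N ≤ n, m ≤ N`, of a doubly infinite
matrix. -/
noncomputable def truncatedDet (A : Matrix ℤ ℤ ℂ) (N : ℕ) : ℂ :=
  (A.submatrix (fun n : Finset.Icc (-(N : ℤ)) (N : ℤ) => (n : ℤ))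
    (fun n : Finset.Icc (-(N : ℤ)) (N : ℤ) => (n : ℤ))).det

/-- A doubly infinite matrix is of Hill type if the entries of its difference from the identity
are absolutely summable. -/
def IsHillType (A : Matrix ℤ ℤ ℂ) : Prop :=
  Summable fun p : ℤ × ℤ => ‖(A - 1) p.1 p.2‖

/-- The determinant of a doubly infinite matrix, the limit of its central truncations. -/
noncomputable def infiniteDet (A : Matrix ℤ ℤ ℂ) : ℂ :=
  Filter.limUnder Filter.atTop (truncatedDet A)

/-- Matrix of the linear system for the Fourier coefficients `a_m` of a solution
`g(η) = ∑ a_m e^{imη}` of `g'' + Q(η) g = μ g`: the `n`-th equation is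
`-n² a_n + ∑_m Q_{n-m} a_m - μ a_n = 0`. -/
noncomputable def hillFourierSystem (Q : ℝ → ℂ) (μ : ℂ) : Matrix ℤ ℤ ℂ :=
  Matrix.of fun n m => hillFourier Q (n - m) - if n = m then (n : ℂ) ^ 2 + μ else 0

/-- The normalised Hill matrix of `g'' + Q(η) g = μ g`: each equation of the system for the Fourier
coefficients is divided by its diagonal entry. -/
noncomputable def normalisedHillMatrix (Q : ℝ → ℂ) (μ : ℂ) : Matrix ℤ ℤ ℂ :=
  Matrix.of fun n m => hillFourierSystem Q μ n m / hillFourierSystem Q μ n n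

/-- `κ = -(1 + s²) / (1 - s²)`. -/
noncomputable def hillKappa (s : ℂ) : ℂ := -((1 + s ^ 2) / (1 - s ^ 2))

/-- `g_0 = 1 + κ` and `g_k = κ i^k s^{|k|}` for `k ≠ 0`. -/
noncomputable def hillG (s : ℂ) (k : ℤ) : ℂ :=
  if k = 0 then 1 + hillKappa s else hillKappa s * Complex.I ^ k * s ^ k.natAbs

/-- `g̃_0 = 0` and `g̃_k = g_k` for `k ≠ 0`. -/
noncomputable def hillGTilde (s : ℂ) (k : ℤ) : ℂ :=
  if k = 0 then 0 else hillG s k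

/-- The doubly infinite matrix `g̃_{n-m} / (Λ - n²) + δ_{n,m}`. -/
noncomputable def hillMatrix (s Λ : ℂ) : Matrix ℤ ℤ ℂ :=
  Matrix.of fun n m => hillGTilde s (n - m) / (Λ - (n : ℂ) ^ 2) + if n = m then 1 else 0

/-- `D(Λ) = det (g̃_{n-m} / (Λ - n²) + δ_{n,m})`. -/
noncomputable def hillDet (s Λ : ℂ) : ℂ := infiniteDet (hillMatrix s Λ)

/-- The right-hand side `2 - 4 D(g_0 - μ) sin² (π √(g_0 - μ))` of Hill's formula (it does not depend
on the branch of the square root). -/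
noncomputable def hillFormula (s μ : ℂ) : ℂ :=
  2 - 4 * hillDet s (hillG s 0 - μ) *
    Complex.sin ((Real.pi : ℂ) * (hillG s 0 - μ) ^ (1 / 2 : ℂ)) ^ 2

/-! Put w² = g_0 − μ. A solution with multiplier e^{2πiν} has coefficients relative to the
exponentials e^{i(m+ν)t}, and these satisfy an infinite linear system with diagonal w² − (n+ν)² and
off-diagonal entries g_{n−m}. Dividing each row by a nowhere vanishing weight of size about n²
leaves a matrix that differs from the identity by absolutely summable entries, locally uniformly in
ν. Its determinant R(ν), `regularDet`, is therefore entire. Dividing by the diagonal instead gives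
`floquetMatrix`, with determinant D at ν = 0. Euler's sine product compares the two normalisations:
away from the poles, R(ν) is (cos 2πν − cos 2πw) / (2π²) times the Floquet determinant.

R is even, has period one and is O(cos 2πν) towards ±i∞, so Liouville's theorem makes it an affine
function of cos 2πν (`exists_eq_add_mul_cos`). The Floquet determinant tends to 1 as ν → i∞, hence
the slope is 1/(2π²) (`regularDet_sub_regularDet`).

The monodromy matrix has determinant 1, so its trace is 2 cos 2πν for an eigenvalue e^{2πiν}. An
eigenvector gives a Floquet solution; its coefficients form a nonzero bounded vector in the kernel
of the system, which forces R(ν) = 0 (`finsetDet_eq_zero_of_kernel`). Comparing R at 0 and at ν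
yields Hill's formula. A single zero of R suffices, so multiplicities play no role.

The Fourier series of Q is a Poisson kernel, the sum of two geometric series. The excluded values of
μ are isolated and the discriminant is continuous in μ by Gronwall's inequality, whence the formula
extends to them. -/

open Filter Topology Finset

/-! ### Finite determinants: bounds and Lipschitz dependence on the rows -/

section FiniteDeterminant

variable {n : Type*} [Fintype n] [DecidableEq n]

/-- A determinant is bounded by the product of the `ℓ¹` norms of the rows. -/
theorem norm_det_le_prod_sum (B : Matrix n n ℂ) : ‖B.det‖ ≤ ∏ i, ∑ j, ‖B i j‖ := by
  rw [← Matrix.det_transpose, Matrix.det_apply', Finset.prod_univ_sum]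
  refine (norm_sum_le _ _).trans ?_
  have h : ∀ σ : Equiv.Perm n, ‖((Equiv.Perm.sign σ : ℤ) : ℂ) * ∏ i, B.transpose (σ i) i‖
      = ∏ i, ‖B i (σ i)‖ := by
    intro σ
    rcases Int.units_eq_one_or (Equiv.Perm.sign σ) with h | h <;>
      simp [h, Matrix.transpose_apply]
  simp only [h]
  -- Expanding the product of row sums gives a sum over all maps n → n; the permutations are only
  -- some of them.
  rw [← Finset.sum_image (f := fun x : n → n => ∏ i, ‖B i (x i)‖)
    (g := fun σ : Equiv.Perm n => (σ : n → n)) (fun a _ b _ h => DFunLike.coe_injective h)]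
  exact Finset.sum_le_sum_of_subset_of_nonneg (fun f _ => by simp)
    (fun f _ _ => Finset.prod_nonneg fun i _ => norm_nonneg _)

/-- Lipschitz dependence of the determinant on the rows, in the `ℓ¹` norm. -/
theorem norm_det_sub_det_le (B C : Matrix n n ℂ) (R : n → ℝ) (hR : ∀ i, 1 ≤ R i)
    (hB : ∀ i, ∑ j, ‖B i j‖ ≤ R i) (hC : ∀ i, ∑ j, ‖C i j‖ ≤ R i) :
    ‖B.det - C.det‖ ≤ (∑ i, ∑ j, ‖B i j - C i j‖) * ∏ i, R i := by
  have hR0 : ∀ i, 0 ≤ R i := fun i => zero_le_one.trans (hR i)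
  -- The rows of `C` are replaced by those of `B` one at a time. By linearity in the row, each
  -- replacement changes the determinant by one determinant with a difference row.
  have key : ∀ s : Finset n,
      ‖(Matrix.of fun i => if i ∈ s then B i else C i).det - C.det‖ ≤
        (∑ i ∈ s, ∑ j, ‖B i j - C i j‖) * ∏ i, R i := by
    intro s
    induction s using Finset.induction_on with
    | empty =>
      have : (Matrix.of fun i => if i ∈ (∅ : Finset n) then B i else C i) = C := by ext; simp
      rw [this]; simp
    | insert a s ha ih =>
      set H : Matrix n n ℂ := Matrix.of fun i => if i ∈ s then B i else C i with hH
      have h1 : (Matrix.of fun i => if i ∈ insert a s then B i else C i) = H.updateRow a (B a) := by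
        ext i j
        by_cases hi : i = a
        · subst hi; simp
        · simp [hi, hH]
      have h2 : H = H.updateRow a (C a) := by
        ext i j
        by_cases hi : i = a
        · subst hi; simp [hH, ha]
        · simp [hi]
      have h3 : (H.updateRow a (B a)).det - H.det = (H.updateRow a (B a - C a)).det := by
        have := Matrix.det_updateRow_add H a (B a - C a) (C a)
        rw [sub_add_cancel, ← h2] at this
        rw [this, add_sub_cancel_right]
      have h4 : ‖(H.updateRow a (B a - C a)).det‖ ≤ (∑ j, ‖B a j - C a j‖) * ∏ i, R i := by
        refine (norm_det_le_prod_sum _).trans ?_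
        rw [← Finset.mul_prod_erase _ _ (Finset.mem_univ a)]
        have h5 : ∏ i ∈ univ.erase a, ∑ j, ‖H.updateRow a (B a - C a) i j‖ ≤ ∏ i, R i := by
          rw [← Finset.mul_prod_erase _ R (Finset.mem_univ a)]
          refine le_trans ?_ (le_mul_of_one_le_left (Finset.prod_nonneg fun i _ => hR0 i) (hR a))
          refine Finset.prod_le_prod (fun i _ => Finset.sum_nonneg fun j _ => norm_nonneg _) ?_
          intro i hi
          have hia : i ≠ a := Finset.ne_of_mem_erase hi
          by_cases his : i ∈ s
          · simpa [hia, hH, his] using hB i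
          · simpa [hia, hH, his] using hC i
        refine mul_le_mul (le_of_eq (by simp)) h5
          (Finset.prod_nonneg fun i _ => Finset.sum_nonneg fun j _ => norm_nonneg _)
          (Finset.sum_nonneg fun j _ => norm_nonneg _)
      rw [h1, Finset.sum_insert ha, add_mul]
      calc ‖(H.updateRow a (B a)).det - C.det‖
          = ‖((H.updateRow a (B a)).det - H.det) + (H.det - C.det)‖ := by congr 1; ring
        _ ≤ _ := (norm_add_le _ _).trans (add_le_add (h3 ▸ h4) ih)
  have := key univ
  have hB' : (Matrix.of fun i => if i ∈ (univ : Finset n) then B i else C i) = B := by ext; simp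
  rwa [hB'] at this

end FiniteDeterminant

/-! ### Infinite determinants as limits over finite index sets -/

section InfiniteDeterminant

/-- From 1 + x ≤ exp x. It bounds all truncated determinants and their cofactors independently of
the truncation. -/
theorem prod_one_add_row_sum_le {ι : Type*} {b : ι × ι → ℝ} (hb : ∀ p, 0 ≤ b p) (hs : Summable b)
    (T : Finset ι) : ∏ i : T, (1 + ∑ j ∈ T, b (i, j)) ≤ Real.exp (∑' p, b p) := by
  calc ∏ i : T, (1 + ∑ j ∈ T, b (i, j)) ≤ ∏ i : T, Real.exp (∑ j ∈ T, b (i, j)) := by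
        refine Finset.prod_le_prod (fun i _ => ?_) (fun i _ => ?_)
        · exact add_nonneg zero_le_one (Finset.sum_nonneg fun j _ => hb _)
        · rw [add_comm]; exact Real.add_one_le_exp _
    _ = Real.exp (∑ p ∈ T ×ˢ T, b p) := by
        rw [← Real.exp_sum, Finset.sum_product, ← Finset.sum_coe_sort T]
    _ ≤ _ := Real.exp_le_exp.2 (hs.sum_le_tsum _ fun p _ => hb p)

variable {ι : Type*} [DecidableEq ι]

/-- The determinant of the truncation of a matrix to a finite set of indices. -/
noncomputable def detOn (A : Matrix ι ι ℂ) (S : Finset ι) : ℂ :=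
  (A.submatrix (fun i : S => (i : ι)) (fun i : S => (i : ι))).det

/-- The limit of the determinants of the finite truncations of a matrix. -/
noncomputable def finsetDet (A : Matrix ι ι ℂ) : ℂ := limUnder atTop (detOn A)

theorem detOn_empty (A : Matrix ι ι ℂ) : detOn A ∅ = 1 := by
  simp [detOn]

/-- Entrywise domination of `A - 1` by a family of real numbers. -/
def DominatedBy (A : Matrix ι ι ℂ) (b : ι × ι → ℝ) : Prop :=
  ∀ i j, ‖(A - 1) i j‖ ≤ b (i, j)

theorem DominatedBy.nonneg {A : Matrix ι ι ℂ} {b : ι × ι → ℝ} (h : DominatedBy A b) (p : ι × ι) :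
    0 ≤ b p := (norm_nonneg _).trans (h p.1 p.2)

/-- The matrix which agrees with `A` on `S × S` and with the identity elsewhere. -/
noncomputable def cutMatrix (A : Matrix ι ι ℂ) (S : Finset ι) : Matrix ι ι ℂ :=
  Matrix.of fun i j => if i ∈ S ∧ j ∈ S then A i j else (1 : Matrix ι ι ℂ) i j

/-- Padding with the identity makes the matrix block triangular with one trivial block. Truncations
of different sizes thus become determinants of the same size, to which the Lipschitz estimate
applies. -/
theorem detOn_cutMatrix (A : Matrix ι ι ℂ) {S T : Finset ι} (h : S ⊆ T) :
    detOn (cutMatrix A S) T = detOn A S := by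
  unfold detOn
  rw [Matrix.twoBlockTriangular_det _ (fun i : T => (i : ι) ∈ S)]
  · have h2 : (Matrix.toSquareBlockProp ((cutMatrix A S).submatrix (fun i : T => (i : ι))
        (fun i : T => (i : ι))) (fun i : T => ¬ (i : ι) ∈ S)) = 1 := by
      ext i j
      simp only [Matrix.toSquareBlockProp_def, cutMatrix, Matrix.submatrix_apply, Matrix.of_apply,
        Matrix.one_apply]
      rw [if_neg (fun h => i.2 h.1)]
      by_cases hij : i = j
      · subst hij; simp
      · rw [if_neg hij, if_neg (fun h => hij (Subtype.ext (Subtype.ext h)))]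
    rw [h2, Matrix.det_one, mul_one]
    let e : S ≃ {i : T // (i : ι) ∈ S} :=
      { toFun := fun i => ⟨⟨i, h i.2⟩, i.2⟩
        invFun := fun i => ⟨i.1, i.2⟩
        left_inv := fun i => rfl
        right_inv := fun i => rfl }
    rw [← Matrix.det_submatrix_equiv_self e]
    congr 1
    ext i j
    simp [Matrix.toSquareBlockProp_def, cutMatrix, e]
  · intro i hi j hj
    simp only [cutMatrix, Matrix.submatrix_apply, Matrix.of_apply]
    rw [if_neg (fun h => hi h.1), Matrix.one_apply_ne]
    rintro hij
    exact hi (hij ▸ hj)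

theorem DominatedBy.cutMatrix {A : Matrix ι ι ℂ} {b : ι × ι → ℝ} (h : DominatedBy A b)
    (S : Finset ι) : DominatedBy (cutMatrix A S) b := by
  intro i j
  simp only [_root_.cutMatrix, Matrix.sub_apply, Matrix.of_apply]
  split_ifs
  · exact h i j
  · simpa using h.nonneg (i, j)

theorem DominatedBy.row_sum_le {A : Matrix ι ι ℂ} {b : ι × ι → ℝ} (h : DominatedBy A b)
    (T : Finset ι) (i : T) : ∑ j : T, ‖A i j‖ ≤ 1 + ∑ j ∈ T, b (i, j) := by
  have h1 : ∀ j : T, ‖A i j‖ ≤ (if j = i then 1 else 0) + b (i, j) := by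
    intro j
    have h2 : A i j = (1 : Matrix ι ι ℂ) i j + (A - 1) i j := by simp
    rw [h2]
    refine (norm_add_le _ _).trans (add_le_add ?_ (h i j))
    by_cases hij : j = i
    · subst hij; simp
    · rw [if_neg hij, Matrix.one_apply_ne (fun h => hij (Subtype.ext h.symm)), norm_zero]
  refine (Finset.sum_le_sum fun j _ => h1 j).trans ?_
  rw [Finset.sum_add_distrib, Finset.sum_ite_eq' univ i, ← Finset.sum_coe_sort T]
  simp

/-- The padded and the full truncation differ only outside `S ×ˢ S`, so the Lipschitz estimate
leaves a tail of the sum of `b`. The bound depends on `b` alone, which gives uniformity for families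
of matrices. -/
theorem norm_detOn_sub_detOn_le {A : Matrix ι ι ℂ} {b : ι × ι → ℝ} (h : DominatedBy A b)
    (hs : Summable b) {S T : Finset ι} (hST : S ⊆ T) :
    ‖detOn A T - detOn A S‖ ≤ (∑' p, b p - ∑ p ∈ S ×ˢ S, b p) * Real.exp (∑' p, b p) := by
  rw [← detOn_cutMatrix A hST]
  have hb := h.nonneg
  refine (norm_det_sub_det_le _ _ (fun i : T => 1 + ∑ j ∈ T, b (i, j)) (fun i => ?_)
    (h.row_sum_le T) ((h.cutMatrix S).row_sum_le T)).trans ?_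
  · exact le_add_of_nonneg_right (Finset.sum_nonneg fun j _ => hb _)
  · have h1 : ∑ i : T, ∑ j : T, ‖A i j - cutMatrix A S i j‖ ≤
        ∑' p, b p - ∑ p ∈ S ×ˢ S, b p := by
      have h2 : ∀ i j, ‖A i j - cutMatrix A S i j‖ ≤ if (i, j) ∈ S ×ˢ S then 0 else b (i, j) := by
        intro i j
        simp only [cutMatrix, Matrix.of_apply, Finset.mem_product]
        split_ifs
        · simp
        · exact h i j
      calc ∑ i : T, ∑ j : T, ‖A i j - cutMatrix A S i j‖
          = ∑ i ∈ T, ∑ j ∈ T, ‖A i j - cutMatrix A S i j‖ := by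
            rw [← Finset.sum_coe_sort T]
            exact Finset.sum_congr rfl fun i _ =>
              Finset.sum_coe_sort T (fun j => ‖A i j - cutMatrix A S i j‖)
        _ ≤ ∑ i ∈ T, ∑ j ∈ T, if (i, j) ∈ S ×ˢ S then 0 else b (i, j) :=
            Finset.sum_le_sum fun i _ => Finset.sum_le_sum fun j _ => h2 i j
        _ = ∑ p ∈ (T ×ˢ T) \ (S ×ˢ S), b p := by
            rw [← Finset.sum_product', Finset.sdiff_eq_filter, Finset.sum_filter]
            exact Finset.sum_congr rfl fun p _ => by by_cases hp : p ∈ S ×ˢ S <;> simp [hp]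
        _ = ∑ p ∈ T ×ˢ T, b p - ∑ p ∈ S ×ˢ S, b p := by
            rw [eq_sub_iff_add_eq, Finset.sum_sdiff (Finset.product_subset_product hST hST)]
        _ ≤ _ := by gcongr; exact hs.sum_le_tsum _ fun p _ => hb p
    refine mul_le_mul h1 (prod_one_add_row_sum_le hb hs T)
      (Finset.prod_nonneg fun i _ => ?_) (h1.trans' ?_)
    · exact add_nonneg zero_le_one (Finset.sum_nonneg fun j _ => hb _)
    · exact Finset.sum_nonneg fun i _ => Finset.sum_nonneg fun j _ => norm_nonneg _

theorem tendsto_product_self_atTop :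
    Tendsto (fun S : Finset ι => S ×ˢ S) atTop atTop := by
  refine tendsto_atTop.2 fun U => ?_
  filter_upwards [eventually_ge_atTop (U.image Prod.fst ∪ U.image Prod.snd)] with S hS p hp
  exact Finset.mem_product.2 ⟨hS (Finset.mem_union_left _ (Finset.mem_image_of_mem _ hp)),
    hS (Finset.mem_union_right _ (Finset.mem_image_of_mem _ hp))⟩

theorem tendsto_tail_product {b : ι × ι → ℝ} (hs : Summable b) :
    Tendsto (fun S : Finset ι => (∑' p, b p - ∑ p ∈ S ×ˢ S, b p) * Real.exp (∑' p, b p)) atTop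
      (𝓝 0) := by
  have h1 : Tendsto (fun S : Finset ι => ∑ p ∈ S ×ˢ S, b p) atTop (𝓝 (∑' p, b p)) :=
    hs.hasSum.comp tendsto_product_self_atTop
  simpa using (h1.const_sub (∑' p, b p)).mul_const (Real.exp (∑' p, b p))

/-- The truncated determinants converge along all finite sets of indices. -/
theorem tendsto_detOn {A : Matrix ι ι ℂ} {b : ι × ι → ℝ} (h : DominatedBy A b)
    (hs : Summable b) : Tendsto (detOn A) atTop (𝓝 (finsetDet A)) := by
  refine CauchySeq.tendsto_limUnder ?_
  refine Metric.cauchySeq_iff'.2 fun ε hε => ?_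
  obtain ⟨S, hS⟩ := ((tendsto_tail_product hs).eventually (gt_mem_nhds hε)).exists
  exact ⟨S, fun T hT => by
    rw [dist_eq_norm]; exact (norm_detOn_sub_detOn_le h hs hT).trans_lt hS⟩

theorem norm_finsetDet_sub_detOn_le {A : Matrix ι ι ℂ} {b : ι × ι → ℝ} (h : DominatedBy A b)
    (hs : Summable b) (S : Finset ι) :
    ‖finsetDet A - detOn A S‖ ≤
      (∑' p, b p - ∑ p ∈ S ×ˢ S, b p) * Real.exp (∑' p, b p) := by
  refine le_of_tendsto ((tendsto_detOn h hs).sub_const _).norm ?_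
  filter_upwards [eventually_ge_atTop S] with T hT
  exact norm_detOn_sub_detOn_le h hs hT

theorem norm_finsetDet_sub_one_le {A : Matrix ι ι ℂ} {b : ι × ι → ℝ} (h : DominatedBy A b)
    (hs : Summable b) : ‖finsetDet A - 1‖ ≤ (∑' p, b p) * Real.exp (∑' p, b p) := by
  simpa [detOn_empty] using norm_finsetDet_sub_detOn_le h hs ∅

/-- The determinant of a dominated family converges uniformly. -/
theorem tendstoUniformlyOn_detOn {α : Type*} {A : α → Matrix ι ι ℂ} {b : ι × ι → ℝ} {K : Set α}
    (h : ∀ z ∈ K, DominatedBy (A z) b) (hs : Summable b) :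
    TendstoUniformlyOn (fun (S : Finset ι) z => detOn (A z) S) (fun z => finsetDet (A z))
      atTop K := by
  refine Metric.tendstoUniformlyOn_iff.2 fun ε hε => ?_
  filter_upwards [(tendsto_tail_product hs).eventually (gt_mem_nhds hε)] with S hS z hz
  rw [dist_eq_norm]
  exact (norm_finsetDet_sub_detOn_le (h z hz) hs S).trans_lt hS

theorem finsetDet_reindex {A : Matrix ι ι ℂ} {b : ι × ι → ℝ} (h : DominatedBy A b)
    (hs : Summable b) (e : ι ≃ ι) : finsetDet (A.submatrix e e) = finsetDet A := by
  refine Tendsto.limUnder_eq ?_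
  have h1 : Tendsto (fun S : Finset ι => S.map e.toEmbedding) atTop atTop := by
    refine tendsto_atTop.2 fun U => ?_
    filter_upwards [eventually_ge_atTop (U.map e.symm.toEmbedding)] with S hS x hx
    have : e.symm x ∈ S := hS (Finset.mem_map_of_mem _ hx)
    simpa using Finset.mem_map_of_mem e.toEmbedding this
  refine ((tendsto_detOn h hs).comp h1).congr fun S => ?_
  simp only [Function.comp, detOn]
  let f : S ≃ (S.map e.toEmbedding : Finset ι) := e.subtypeEquiv (fun a => by simp)
  rw [← Matrix.det_submatrix_equiv_self f]
  rfl

/-- A matrix with a nonzero bounded vector in its kernel has determinant zero. -/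
theorem finsetDet_eq_zero_of_kernel {A : Matrix ι ι ℂ} {b : ι × ι → ℝ} (h : DominatedBy A b)
    (hs : Summable b) {x : ι → ℂ} {X : ℝ} (hX : ∀ i, ‖x i‖ ≤ X)
    (hx : ∀ i, HasSum (fun j => A i j * x j) 0) {k : ι} (hk : x k ≠ 0) : finsetDet A = 0 := by
  have hb := h.nonneg
  have hX0 : 0 ≤ X := (norm_nonneg _).trans (hX k)
  have hrow : ∀ i, Summable fun j => b (i, j) := fun i => hs.prod_factor i
  -- Cramer's rule: adj(B) B x = det(B) x. Since the full rows annihilate x, the vector B x is minus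
  -- the part of the rows outside `S`, which is small.
  have key : ∀ S : Finset ι, k ∈ S → ‖detOn A S * x k‖ ≤
      X * ((∑' p, b p - ∑ p ∈ S ×ˢ S, b p) * Real.exp (∑' p, b p)) := by
    intro S hkS
    set B : Matrix S S ℂ := A.submatrix (fun i : S => (i : ι)) (fun i : S => (i : ι)) with hB
    set y : S → ℂ := B.mulVec (fun j => x j) with hy
    have h1 : detOn A S * x k = ∑ j, B.adjugate ⟨k, hkS⟩ j * y j := by
      have h2 : B.adjugate.mulVec y = B.det • fun j : S => x j := by
        rw [hy, Matrix.mulVec_mulVec, Matrix.adjugate_mul, Matrix.smul_mulVec, Matrix.one_mulVec]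
      have := congrFun h2 ⟨k, hkS⟩
      simp only [Pi.smul_apply, smul_eq_mul] at this
      rw [detOn, ← this]
      rfl
    -- A cofactor is the determinant with one row replaced by a unit vector, whose ℓ¹ norm is 1.
    have hadj : ∀ i j, ‖B.adjugate i j‖ ≤ Real.exp (∑' p, b p) := by
      intro i j
      rw [Matrix.adjugate_apply]
      refine (norm_det_le_prod_sum _).trans (le_trans ?_ (prod_one_add_row_sum_le hb hs S))
      refine Finset.prod_le_prod (fun l _ => Finset.sum_nonneg fun m _ => norm_nonneg _) ?_
      intro l _
      by_cases hl : l = j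
      · subst hl
        rw [Finset.sum_eq_single i]
        · simpa using Finset.sum_nonneg fun m (_ : m ∈ S) => hb (l, m)
        · intro m _ hm; simp [hm]
        · simp
      · simpa [hl, hB] using h.row_sum_le S l
    have hyb : ∀ j : S, ‖y j‖ ≤ X * (∑' m, b (j, m) - ∑ m ∈ S, b (j, m)) := by
      intro j
      have h3 : HasSum (fun m : {m // m ∉ S} => A j m * x m) (0 - y j) := by
        have h4 : y j = ∑ m ∈ S, A j m * x m := by
          rw [← Finset.sum_coe_sort S]; rfl
        rw [h4]
        exact (Finset.hasSum_iff_compl (f := fun m => A j m * x m) S).1 (hx j)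
      have h5 : HasSum (fun m : {m // m ∉ S} => b (j, m))
          (∑' m, b (j, m) - ∑ m ∈ S, b (j, m)) :=
        (Finset.hasSum_iff_compl (f := fun m => b (j, m)) S).1 (hrow j).hasSum
      have h6 : ∀ m : {m // m ∉ S}, ‖A j m * x m‖ ≤ X * b (j, m) := by
        intro m
        have hjm : (j : ι) ≠ m := fun hjm => m.2 (hjm ▸ j.2)
        have h7 : A j m = (A - 1) j m := by simp [Matrix.one_apply_ne hjm]
        rw [norm_mul, mul_comm, h7]
        exact mul_le_mul (hX m) (h j m) (norm_nonneg _) hX0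
      have h8 := tsum_of_norm_bounded (h5.mul_left X) h6
      rwa [h3.tsum_eq, zero_sub, norm_neg] at h8
    have hsum : ∑ j : S, (∑' m, b (j, m) - ∑ m ∈ S, b (j, m)) ≤
        ∑' p, b p - ∑ p ∈ S ×ˢ S, b p := by
      rw [Finset.sum_sub_distrib, Finset.sum_coe_sort S (fun j => ∑' m, b (j, m)),
        Finset.sum_coe_sort S (fun j => ∑ m ∈ S, b (j, m)), Finset.sum_product]
      gcongr
      rw [hs.tsum_prod]
      exact hs.prod.sum_le_tsum _ fun i _ => tsum_nonneg fun m => hb _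
    rw [h1]
    calc ‖∑ j, B.adjugate ⟨k, hkS⟩ j * y j‖
        ≤ ∑ j : S, Real.exp (∑' p, b p) * (X * (∑' m, b (j, m) - ∑ m ∈ S, b (j, m))) := by
          refine norm_sum_le_of_le _ fun j _ => ?_
          rw [norm_mul]
          exact mul_le_mul (hadj _ j) (hyb j) (norm_nonneg _) (Real.exp_pos _).le
      _ = X * ((∑ j : S, (∑' m, b (j, m) - ∑ m ∈ S, b (j, m))) * Real.exp (∑' p, b p)) := by
          rw [← Finset.mul_sum, ← Finset.mul_sum]; ring
      _ ≤ _ := by gcongr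
  have h1 : Tendsto (fun S => detOn A S * x k) atTop (𝓝 0) := by
    refine squeeze_zero_norm' ?_ (by simpa using (tendsto_tail_product hs).const_mul X)
    filter_upwards [eventually_ge_atTop {k}] with S hS
    exact key S (hS (Finset.mem_singleton_self k))
  have h2 := tendsto_nhds_unique h1 ((tendsto_detOn h hs).mul_const (x k))
  exact (mul_eq_zero.1 h2.symm).resolve_right hk

end InfiniteDeterminant

/-! ### Central truncations, sums and products over the integers -/

theorem tendsto_Icc_neg_atTop :
    Tendsto (fun N : ℕ => Finset.Icc (-(N : ℤ)) (N : ℤ)) atTop atTop := by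
  refine tendsto_atTop_finset_of_monotone ?_ ?_
  · intro a b hab
    exact Finset.Icc_subset_Icc (by simpa using hab) (by simpa using hab)
  · intro x
    exact ⟨x.natAbs, by simp only [Finset.mem_Icc]; omega⟩

theorem tendsto_truncatedDet {A : Matrix ℤ ℤ ℂ} {b : ℤ × ℤ → ℝ} (h : DominatedBy A b)
    (hs : Summable b) : Tendsto (truncatedDet A) atTop (𝓝 (finsetDet A)) :=
  (tendsto_detOn h hs).comp tendsto_Icc_neg_atTop

theorem infiniteDet_eq_finsetDet {A : Matrix ℤ ℤ ℂ} {b : ℤ × ℤ → ℝ} (h : DominatedBy A b)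
    (hs : Summable b) : infiniteDet A = finsetDet A :=
  (tendsto_truncatedDet h hs).limUnder_eq

theorem summable_mul_sub {u v : ℤ → ℝ} (hu : Summable u) (hv : Summable v) (hu0 : ∀ n, 0 ≤ u n)
    (hv0 : ∀ n, 0 ≤ v n) : Summable fun p : ℤ × ℤ => u p.1 * v (p.1 - p.2) := by
  -- The shear (n, m) ↦ (n, n − m) is an involution and turns the family into a product family.
  let e : ℤ × ℤ ≃ ℤ × ℤ :=
    { toFun := fun p => (p.1, p.1 - p.2)
      invFun := fun p => (p.1, p.1 - p.2)
      left_inv := fun p => by ext <;> simp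
      right_inv := fun p => by ext <;> simp }
  exact (e.summable_iff (f := fun p : ℤ × ℤ => u p.1 * v p.2)).2
    (Summable.mul_of_nonneg hu hv hu0 hv0)

theorem tsum_mul_sub {u v : ℤ → ℝ} (hu : Summable u) (hv : Summable v) (hu0 : ∀ n, 0 ≤ u n)
    (hv0 : ∀ n, 0 ≤ v n) : ∑' p : ℤ × ℤ, u p.1 * v (p.1 - p.2) = (∑' n, u n) * ∑' n, v n := by
  rw [(summable_mul_sub hu hv hu0 hv0).tsum_prod, ← tsum_mul_right]
  refine tsum_congr fun n => ?_
  simp only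
  rw [tsum_mul_left, ← (Equiv.subLeft n).tsum_eq v]
  rfl

/-- Pairing n with −n matches the factors of Euler's sine product and lets the exponential row
weights cancel. -/
theorem prod_Icc_neg (f : ℤ → ℂ) (N : ℕ) :
    ∏ n ∈ Finset.Icc (-(N : ℤ)) (N : ℤ), f n =
      f 0 * ∏ j ∈ Finset.range N, (f ((j : ℤ) + 1) * f (-((j : ℤ) + 1))) := by
  induction N with
  | zero => simp
  | succ N ih =>
    have h : Finset.Icc (-((N + 1 : ℕ) : ℤ)) ((N + 1 : ℕ) : ℤ) =
        insert ((N : ℤ) + 1) (insert (-((N : ℤ) + 1)) (Finset.Icc (-(N : ℤ)) (N : ℤ))) := by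
      ext x
      simp only [Finset.mem_Icc, Finset.mem_insert]
      push_cast
      omega
    rw [h, Finset.prod_insert, Finset.prod_insert, ih, Finset.prod_range_succ]
    · ring
    · simp
    · simp only [Finset.mem_insert, Finset.mem_Icc]
      omega

theorem summable_inv_one_add_sq_int : Summable fun n : ℤ => (1 + (n : ℝ) ^ 2)⁻¹ := by
  have h : Summable fun n : ℤ => 1 / (n : ℝ) ^ 2 :=
    (Real.summable_one_div_int_pow (p := 2)).2 (by norm_num)
  refine Summable.of_norm_bounded_eventually h ?_
  have h0 : ∀ᶠ n : ℤ in cofinite, n ≠ 0 := by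
    simpa using (Set.finite_singleton (0 : ℤ)).compl_mem_cofinite
  filter_upwards [h0] with n hn
  have hn' : (0 : ℝ) < (n : ℝ) ^ 2 := by positivity
  rw [Real.norm_of_nonneg (by positivity), one_div]
  exact inv_anti₀ hn' (by linarith)

/-! ### The Floquet matrix and its entire normalisation -/

/-- The matrix `δ_{n,m} + γ_{n-m} / (w² - (n + ν)²)`. -/
noncomputable def floquetMatrix (γ : ℤ → ℂ) (w ν : ℂ) : Matrix ℤ ℤ ℂ :=
  Matrix.of fun n m => γ (n - m) / (w ^ 2 - ((n : ℂ) + ν) ^ 2) + if n = m then 1 else 0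

/-- Nowhere vanishing normalising factors for the rows of the Floquet system. -/
noncomputable def rowWeight (ν : ℂ) (n : ℤ) : ℂ :=
  if n = 0 then 1 else -((n : ℂ) ^ 2 * Complex.exp (2 * ν / n))

/-- The Floquet system, normalised so that it depends holomorphically on the exponent `ν`. -/
noncomputable def regularMatrix (γ : ℤ → ℂ) (w ν : ℂ) : Matrix ℤ ℤ ℂ :=
  Matrix.of fun n m =>
    ((if n = m then w ^ 2 - ((n : ℂ) + ν) ^ 2 else 0) + γ (n - m)) / rowWeight ν n

theorem rowWeight_ne_zero (ν : ℂ) (n : ℤ) : rowWeight ν n ≠ 0 := by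
  unfold rowWeight
  split_ifs with h
  · exact one_ne_zero
  · exact neg_ne_zero.2 (mul_ne_zero (pow_ne_zero 2 (Int.cast_ne_zero.2 h)) (Complex.exp_ne_zero _))

section bounds

variable {γ : ℤ → ℂ}

/-- No pole has to be excluded: where the denominator vanishes, both the entry and its bound take
the value of division by zero, namely 0. -/
theorem floquetMatrix_dominatedBy (w ν : ℂ) :
    DominatedBy (floquetMatrix γ w ν)
      (fun p => ‖(w ^ 2 - ((p.1 : ℂ) + ν) ^ 2)⁻¹‖ * ‖γ (p.1 - p.2)‖) := by
  intro i j
  simp only [floquetMatrix, Matrix.sub_apply, Matrix.of_apply, Matrix.one_apply,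
    add_sub_cancel_right, div_eq_inv_mul, norm_mul, le_refl]

theorem norm_le_two_mul_norm_add {n : ℤ} {a : ℂ} (h : 2 * ‖a‖ ≤ |(n : ℝ)|) :
    |(n : ℝ)| ≤ 2 * ‖(n : ℂ) + a‖ := by
  have h1 : |(n : ℝ)| ≤ ‖(n : ℂ) + a‖ + ‖a‖ := by
    have := norm_sub_le ((n : ℂ) + a) a
    rwa [add_sub_cancel_right, Complex.norm_intCast] at this
  linarith

theorem summable_norm_inv_sq_sub_sq (w ν : ℂ) :
    Summable fun n : ℤ => ‖(w ^ 2 - ((n : ℂ) + ν) ^ 2)⁻¹‖ := by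
  have h : Summable fun n : ℤ => 4 * (1 / (n : ℝ) ^ 2) :=
    ((Real.summable_one_div_int_pow (p := 2)).2 (by norm_num)).mul_left 4
  refine Summable.of_norm_bounded_eventually h ?_
  have h0 : ∀ᶠ n : ℤ in cofinite, 2 * ‖ν + w‖ + 2 * ‖ν - w‖ + 1 ≤ |(n : ℝ)| := by
    have := (tendsto_norm_cocompact_atTop (E := ℝ)).comp Int.tendsto_coe_cofinite
    simpa using this.eventually_ge_atTop _
  filter_upwards [h0] with n hn
  have hw := norm_nonneg (ν + w)
  have hw' := norm_nonneg (ν - w)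
  have h1 := norm_le_two_mul_norm_add (n := n) (a := ν + w) (by linarith)
  have h2 := norm_le_two_mul_norm_add (n := n) (a := ν - w) (by linarith)
  have h3 : w ^ 2 - ((n : ℂ) + ν) ^ 2 = -(((n : ℂ) + (ν + w)) * ((n : ℂ) + (ν - w))) := by ring
  have hn0 : 0 < |(n : ℝ)| := by linarith
  rw [norm_norm, norm_inv, h3, norm_neg, norm_mul, ← sq_abs (n : ℝ),
    show 4 * (1 / |(n : ℝ)| ^ 2) = ((|(n : ℝ)| / 2) * (|(n : ℝ)| / 2))⁻¹ by field_simp; norm_num]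
  refine inv_anti₀ (by positivity) ?_
  exact mul_le_mul (by linarith) (by linarith) (by positivity) (norm_nonneg _)

theorem summable_floquet_bound (hγ : Summable fun k => ‖γ k‖) (w ν : ℂ) :
    Summable fun p : ℤ × ℤ => ‖(w ^ 2 - ((p.1 : ℂ) + ν) ^ 2)⁻¹‖ * ‖γ (p.1 - p.2)‖ :=
  summable_mul_sub (u := fun n : ℤ => ‖(w ^ 2 - ((n : ℂ) + ν) ^ 2)⁻¹‖) (v := fun k => ‖γ k‖)
    (summable_norm_inv_sq_sub_sq w ν) hγ (fun _ => norm_nonneg _) fun _ => norm_nonneg _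

theorem norm_inv_rowWeight_le {R : ℝ} {ν : ℂ} (hν : ‖ν‖ ≤ R) (n : ℤ) :
    ‖(rowWeight ν n)⁻¹‖ ≤ 2 * Real.exp (2 * R) * (1 + (n : ℝ) ^ 2)⁻¹ := by
  have hR : 0 ≤ R := (norm_nonneg _).trans hν
  by_cases hn : n = 0
  · subst hn
    have : 1 ≤ Real.exp (2 * R) := Real.one_le_exp (by positivity)
    simp only [rowWeight, if_pos, inv_one, norm_one]
    norm_num
    linarith
  · have hn1 : (1 : ℝ) ≤ (n : ℝ) ^ 2 := by
      have : (1 : ℤ) ≤ n ^ 2 := by have := sq_pos_of_ne_zero hn; omega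
      exact_mod_cast this
    have hn2 : (1 : ℝ) ≤ |(n : ℝ)| := by
      have : (1 : ℤ) ≤ |n| := Int.one_le_abs hn
      exact_mod_cast this
    have h1 : ‖(Complex.exp (2 * ν / n))⁻¹‖ ≤ Real.exp (2 * R) := by
      rw [← Complex.exp_neg]
      refine (Complex.norm_exp_le_exp_norm _).trans (Real.exp_le_exp.2 ?_)
      rw [norm_neg, norm_div, norm_mul, Complex.norm_ofNat, Complex.norm_intCast]
      refine (div_le_self (by positivity) hn2).trans (by linarith)
    rw [rowWeight, if_neg hn, inv_neg, norm_neg, mul_inv, norm_mul, norm_inv, norm_pow,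
      Complex.norm_intCast, sq_abs, mul_comm]
    have h2 : ((n : ℝ) ^ 2)⁻¹ ≤ 2 * (1 + (n : ℝ) ^ 2)⁻¹ := by
      rw [← div_eq_mul_inv, inv_eq_one_div, div_le_div_iff₀ (by linarith) (by linarith)]
      linarith
    calc _ ≤ Real.exp (2 * R) * (2 * (1 + (n : ℝ) ^ 2)⁻¹) := by gcongr
      _ = _ := by ring

/-- This is why the weights carry the factor exp(2ν/n): with t = 2ν/n, the difference between
diagonal entry and weight is n²(exp t − 1 − t) up to a bounded term, hence bounded. Without it a
term of order 1/n would remain, which is not absolutely summable. -/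
theorem exists_norm_diag_sub_one_le (w : ℂ) (R : ℝ) : ∃ K : ℝ, 0 ≤ K ∧ ∀ ν : ℂ, ‖ν‖ ≤ R → ∀ n : ℤ,
    ‖(w ^ 2 - ((n : ℂ) + ν) ^ 2) / rowWeight ν n - 1‖ ≤ K * (1 + (n : ℝ) ^ 2)⁻¹ := by
  by_cases hR : 0 ≤ R
  swap
  · exact ⟨0, le_rfl, fun ν hν => absurd ((norm_nonneg _).trans hν) hR⟩
  -- The first factor bounds the diagonal minus the weight, with the summand 1 for the row n = 0;
  -- the second comes from the bound on the inverse weight.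
  refine ⟨(4 * R ^ 2 * Real.exp (2 * R) + R ^ 2 + ‖w‖ ^ 2 + 1) * (2 * Real.exp (2 * R)),
    by positivity, fun ν hν n => ?_⟩
  have hwν : ‖ν ^ 2 - w ^ 2‖ ≤ R ^ 2 + ‖w‖ ^ 2 := by
    refine (norm_sub_le _ _).trans ?_
    rw [norm_pow, norm_pow]
    gcongr
  have key : ‖w ^ 2 - ((n : ℂ) + ν) ^ 2 - rowWeight ν n‖ ≤
      4 * R ^ 2 * Real.exp (2 * R) + R ^ 2 + ‖w‖ ^ 2 + 1 := by
    by_cases hn : n = 0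
    · subst hn
      have : w ^ 2 - (((0 : ℤ) : ℂ) + ν) ^ 2 - rowWeight ν 0 = -(ν ^ 2 - w ^ 2) - 1 := by
        simp [rowWeight]
      rw [this]
      refine (norm_sub_le _ _).trans ?_
      rw [norm_neg, norm_one]
      have : 0 ≤ 4 * R ^ 2 * Real.exp (2 * R) := by positivity
      linarith
    · have hn2 : (1 : ℝ) ≤ |(n : ℝ)| := by
        have : (1 : ℤ) ≤ |n| := Int.one_le_abs hn
        exact_mod_cast this
      have hnC : (n : ℂ) ≠ 0 := Int.cast_ne_zero.2 hn
      have hnR : (n : ℝ) ≠ 0 := Int.cast_ne_zero.2 hn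
      set t : ℂ := 2 * ν / n with ht
      have hnt : ‖t‖ = 2 * ‖ν‖ / |(n : ℝ)| := by
        rw [ht, norm_div, norm_mul, Complex.norm_ofNat, Complex.norm_intCast]
      have htR : ‖t‖ ≤ 2 * R := by
        rw [hnt]
        refine (div_le_self (by positivity) hn2).trans (by linarith)
      have h1 : ‖Complex.exp t - (1 + t)‖ ≤ ‖t‖ ^ 2 * Real.exp ‖t‖ := by
        simpa [Finset.sum_range_succ] using Complex.norm_exp_sub_sum_le_norm_mul_exp t 2
      have h2 : w ^ 2 - ((n : ℂ) + ν) ^ 2 - rowWeight ν n =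
          (n : ℂ) ^ 2 * (Complex.exp t - (1 + t)) - (ν ^ 2 - w ^ 2) := by
        have : (n : ℂ) ^ 2 * t = 2 * ν * n := by rw [ht]; field_simp
        rw [rowWeight, if_neg hn]
        linear_combination this
      rw [h2]
      refine (norm_sub_le _ _).trans ?_
      have h3 : ‖(n : ℂ) ^ 2 * (Complex.exp t - (1 + t))‖ ≤ 4 * R ^ 2 * Real.exp (2 * R) := by
        rw [norm_mul, norm_pow, Complex.norm_intCast]
        calc |(n : ℝ)| ^ 2 * ‖Complex.exp t - (1 + t)‖
            ≤ |(n : ℝ)| ^ 2 * (‖t‖ ^ 2 * Real.exp ‖t‖) := by gcongr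
          _ = 4 * ‖ν‖ ^ 2 * Real.exp ‖t‖ := by rw [hnt]; field_simp; ring
          _ ≤ _ := by gcongr
      linarith
  have h1 : (w ^ 2 - ((n : ℂ) + ν) ^ 2) / rowWeight ν n - 1 =
      (w ^ 2 - ((n : ℂ) + ν) ^ 2 - rowWeight ν n) * (rowWeight ν n)⁻¹ := by
    field_simp [rowWeight_ne_zero ν n]
  rw [h1, norm_mul]
  calc _ ≤ _ := mul_le_mul key (norm_inv_rowWeight_le hν n) (norm_nonneg _) (by positivity)
    _ = _ := by ring

theorem exists_regularMatrix_dominatedBy (hγ : Summable fun k => ‖γ k‖) (w : ℂ) (R : ℝ) :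
    ∃ b : ℤ × ℤ → ℝ, Summable b ∧ ∀ ν : ℂ, ‖ν‖ ≤ R → DominatedBy (regularMatrix γ w ν) b := by
  obtain ⟨K, hK0, hK⟩ := exists_norm_diag_sub_one_le w R
  set L : ℝ := K + 2 * Real.exp (2 * R) with hL
  have hL0 : 0 ≤ L := by positivity
  let v : ℤ → ℝ := fun k => (if k = 0 then (1 : ℝ) else 0) + ‖γ k‖
  have hv0 : ∀ k, 0 ≤ v k := fun k => by simp only [v]; split_ifs <;> positivity
  have hv : Summable v := by
    refine Summable.add ?_ hγ
    exact summable_of_ne_finset_zero (s := {0}) fun k hk => by simpa using hk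
  let u : ℤ → ℝ := fun n => L * (1 + (n : ℝ) ^ 2)⁻¹
  have hu0 : ∀ n, 0 ≤ u n := fun n => mul_nonneg hL0 (by positivity)
  refine ⟨fun p => u p.1 * v (p.1 - p.2),
    summable_mul_sub (summable_inv_one_add_sq_int.mul_left L) hv hu0 hv0, ?_⟩
  intro ν hν i j
  have h1 : (regularMatrix γ w ν - 1) i j =
      (if i - j = 0 then (w ^ 2 - ((i : ℂ) + ν) ^ 2) / rowWeight ν i - 1 else 0) +
        γ (i - j) * (rowWeight ν i)⁻¹ := by
    by_cases hij : i = j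
    · subst hij
      simp only [regularMatrix, Matrix.sub_apply, Matrix.of_apply, Matrix.one_apply_eq, if_true,
        sub_self]
      ring
    · have hij' : i - j ≠ 0 := sub_ne_zero.2 hij
      simp only [regularMatrix, Matrix.sub_apply, Matrix.of_apply, Matrix.one_apply_ne hij, if_neg hij,
        if_neg hij']
      ring
  have hw := norm_inv_rowWeight_le hν i
  have hi : (0 : ℝ) < (1 + (i : ℝ) ^ 2)⁻¹ := by positivity
  have hLK : K ≤ L := by rw [hL]; have := Real.exp_pos (2 * R); linarith
  have hLe : 2 * Real.exp (2 * R) ≤ L := by rw [hL]; linarith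
  rw [h1]
  refine (norm_add_le _ _).trans ?_
  simp only [u, v]
  rw [mul_add]
  refine add_le_add ?_ ?_
  · split_ifs
    · rw [mul_one]
      exact (hK ν hν i).trans (by gcongr)
    · simp
  · rw [norm_mul, mul_comm]
    gcongr
    exact hw.trans (by gcongr)

/-- The determinant of the regularised Floquet system, an entire function of the exponent. -/
noncomputable def regularDet (γ : ℤ → ℂ) (w ν : ℂ) : ℂ := finsetDet (regularMatrix γ w ν)

theorem differentiable_detOn_regularMatrix (w : ℂ) (S : Finset ℤ) :
    Differentiable ℂ fun ν => detOn (regularMatrix γ w ν) S := by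
  unfold detOn
  simp only [Matrix.det_apply']
  refine Differentiable.fun_sum fun σ _ => ?_
  refine (differentiable_const _).mul ?_
  refine Differentiable.fun_finsetProd fun i _ => ?_
  simp only [regularMatrix, Matrix.submatrix_apply, Matrix.of_apply]
  have h1 : Differentiable ℂ fun ν : ℂ => rowWeight ν (σ i : S) := by
    unfold rowWeight
    split_ifs <;> fun_prop
  refine Differentiable.div ?_ h1 fun ν => rowWeight_ne_zero _ _
  split_ifs <;> fun_prop

theorem differentiable_regularDet (hγ : Summable fun k => ‖γ k‖) (w : ℂ) :
    Differentiable ℂ (regularDet γ w) := by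
  intro ν
  obtain ⟨b, hb, hdom⟩ := exists_regularMatrix_dominatedBy hγ w (‖ν‖ + 1)
  -- One dominating family serves the whole ball, so the truncations converge uniformly there and
  -- the limit is holomorphic.
  have h1 := tendstoUniformlyOn_detOn (K := Metric.ball 0 (‖ν‖ + 1))
    (fun z hz => hdom z (le_of_lt (by simpa using hz))) hb
  have h2 : DifferentiableOn ℂ (regularDet γ w) (Metric.ball 0 (‖ν‖ + 1)) :=
    h1.tendstoLocallyUniformlyOn.differentiableOn
      (Eventually.of_forall fun S => (differentiable_detOn_regularMatrix w S).differentiableOn)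
      Metric.isOpen_ball
  exact h2.differentiableAt (Metric.isOpen_ball.mem_nhds (by simp))

/-- The weights at n and −n multiply to n⁴, since their exponentials cancel; the rest is the product
of Euler's products for ν − w and ν + w. -/
theorem tendsto_prod_diag (w ν : ℂ) :
    Tendsto (fun N : ℕ => ∏ n ∈ Finset.Icc (-(N : ℤ)) (N : ℤ),
      (w ^ 2 - ((n : ℂ) + ν) ^ 2) / rowWeight ν n) atTop
      (𝓝 (-(Complex.sin (Real.pi * (ν - w)) * Complex.sin (Real.pi * (ν + w)) / Real.pi ^ 2))) := by
  have h1 := (Complex.tendsto_euler_sin_prod (ν - w)).mul (Complex.tendsto_euler_sin_prod (ν + w))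
  refine ((h1.div_const ((Real.pi : ℂ) ^ 2)).neg).congr fun N => ?_
  rw [prod_Icc_neg]
  have hpi : (Real.pi : ℂ) ≠ 0 := Complex.ofReal_ne_zero.2 Real.pi_ne_zero
  have h2 : ∀ j ∈ Finset.range N,
      (w ^ 2 - ((((j : ℤ) + 1 : ℤ) : ℂ) + ν) ^ 2) / rowWeight ν ((j : ℤ) + 1) *
      ((w ^ 2 - (((-((j : ℤ) + 1) : ℤ) : ℂ) + ν) ^ 2) / rowWeight ν (-((j : ℤ) + 1))) =
      (1 - (ν - w) ^ 2 / ((j : ℂ) + 1) ^ 2) * (1 - (ν + w) ^ 2 / ((j : ℂ) + 1) ^ 2) := by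
    intro j _
    have hj : ((j : ℂ) + 1) ≠ 0 := Nat.cast_add_one_ne_zero j
    have hj1 : (j : ℤ) + 1 ≠ 0 := by omega
    have hj2 : -((j : ℤ) + 1) ≠ 0 := by omega
    have hexp : Complex.exp (2 * ν / ((j : ℂ) + 1)) * Complex.exp (2 * ν / (-((j : ℂ) + 1))) = 1 := by
      rw [← Complex.exp_add, div_neg, add_neg_cancel, Complex.exp_zero]
    have he1 := Complex.exp_ne_zero (2 * ν / ((j : ℂ) + 1))
    have he2 : Complex.exp (2 * ν / (-((j : ℂ) + 1))) = (Complex.exp (2 * ν / ((j : ℂ) + 1)))⁻¹ :=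
      eq_inv_of_mul_eq_one_right hexp
    rw [rowWeight, rowWeight, if_neg hj1, if_neg hj2]
    push_cast
    rw [he2]
    field_simp
    ring
  rw [Finset.prod_congr rfl h2, Finset.prod_mul_distrib]
  simp only [rowWeight, if_true, Int.cast_zero, zero_add]
  field_simp
  ring

/-- Away from its poles, the Floquet determinant is a quotient of entire functions. -/
theorem sin_mul_sin_mul_finsetDet (hγ : Summable fun k => ‖γ k‖) (w ν : ℂ)
    (hν : ∀ n : ℤ, w ^ 2 - ((n : ℂ) + ν) ^ 2 ≠ 0) :
    Complex.sin (Real.pi * (ν - w)) * Complex.sin (Real.pi * (ν + w)) *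
      finsetDet (floquetMatrix γ w ν) = -(Real.pi ^ 2 * regularDet γ w ν) := by
  obtain ⟨b, hb, hdom⟩ := exists_regularMatrix_dominatedBy hγ w ‖ν‖
  have h1 := tendsto_truncatedDet (hdom ν le_rfl) hb
  have h2 := (tendsto_prod_diag w ν).mul
    (tendsto_truncatedDet (floquetMatrix_dominatedBy w ν) (summable_floquet_bound hγ w ν))
  have h3 : ∀ N : ℕ, truncatedDet (regularMatrix γ w ν) N =
      (∏ n ∈ Finset.Icc (-(N : ℤ)) (N : ℤ), (w ^ 2 - ((n : ℂ) + ν) ^ 2) / rowWeight ν n) *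
        truncatedDet (floquetMatrix γ w ν) N := by
    intro N
    unfold truncatedDet
    rw [← Finset.prod_coe_sort, ← Matrix.det_mul_column]
    congr 1
    ext i j
    simp only [regularMatrix, floquetMatrix, Matrix.submatrix_apply, Matrix.of_apply,
      Subtype.coe_inj]
    have := hν i
    have := rowWeight_ne_zero ν i
    split_ifs <;> field_simp <;> ring
  have h4 := tendsto_nhds_unique h1 (h2.congr fun N => (h3 N).symm)
  have hpi : (Real.pi : ℂ) ≠ 0 := Complex.ofReal_ne_zero.2 Real.pi_ne_zero
  rw [regularDet, h4]
  field_simp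

end bounds

/-! ### Liouville's theorem for even periodic functions of cosine growth -/

section quotient

/-- Division of entire functions, where the zeros of the denominator are simple. -/
theorem exists_differentiable_quotient {f g : ℂ → ℂ} (hf : Differentiable ℂ f)
    (hg : Differentiable ℂ g) (hfg : ∀ z, g z = 0 → f z = 0) (hg' : ∀ z, g z = 0 → deriv g z ≠ 0) :
    ∃ h : ℂ → ℂ, Differentiable ℂ h ∧ ∀ z, f z = h z * g z := by
  classical
  -- At a common zero the quotient is filled in by the ratio of derivatives; nearby it equals the
  -- quotient of the slopes of f and g, whose denominator does not vanish.
  refine ⟨fun z => if g z = 0 then deriv f z / deriv g z else f z / g z, fun z => ?_, fun z => ?_⟩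
  · by_cases hz : g z = 0
    · have hdf : DifferentiableAt ℂ (dslope f z) z :=
        ((Complex.differentiableOn_dslope univ_mem).2 hf.differentiableOn).differentiableAt univ_mem
      have hdg : DifferentiableAt ℂ (dslope g z) z :=
        ((Complex.differentiableOn_dslope univ_mem).2 hg.differentiableOn).differentiableAt univ_mem
      have hne : dslope g z z ≠ 0 := by rw [dslope_same]; exact hg' z hz
      refine (hdf.div hdg hne).congr_of_eventuallyEq ?_
      filter_upwards [hdg.continuousAt.eventually_ne hne] with x hx
      by_cases hxz : x = z
      · subst hxz
        simp [hz]
      · have h1 : x - z ≠ 0 := sub_ne_zero.2 hxz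
        have h2 : dslope g z x = g x / (x - z) := by
          rw [dslope_of_ne _ hxz, slope_def_field, hz, sub_zero]
        have h3 : dslope f z x = f x / (x - z) := by
          rw [dslope_of_ne _ hxz, slope_def_field, hfg z hz, sub_zero]
        have h4 : g x ≠ 0 := by
          intro h; rw [h2, h, zero_div] at hx; exact hx rfl
        rw [if_neg h4, Pi.div_apply, h2, h3]
        field_simp
    · have h1 : (fun z => if g z = 0 then deriv f z / deriv g z else f z / g z) =ᶠ[𝓝 z]
          fun z => f z / g z := by
        filter_upwards [hg.continuous.continuousAt.eventually_ne hz] with x hx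
        rw [if_neg hx]
      exact ((hf z).div (hg z) hz).congr_of_eventuallyEq h1
  · by_cases hz : g z = 0
    · rw [hz, hfg z hz, mul_zero]
    · simp only [if_neg hz]
      field_simp

/-- By the reverse triangle inequality for the two exponentials |cos z| ≥ |sinh(Im z)|, and |sinh x|
≥ |x|. -/
theorem abs_im_le_norm_cos (z : ℂ) : |z.im| ≤ ‖Complex.cos z‖ := by
  have h1 : |Real.sinh z.im| ≤ ‖Complex.cos z‖ := by
    have h2 := abs_norm_sub_norm_le (Complex.exp (-z * Complex.I)) (-Complex.exp (z * Complex.I))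
    rw [norm_neg, sub_neg_eq_add, Complex.norm_exp, Complex.norm_exp] at h2
    have h3 : Complex.cos z =
      (Complex.exp (-z * Complex.I) + Complex.exp (z * Complex.I)) / 2 := by
      rw [Complex.cos, add_comm]
    rw [h3, norm_div, Real.sinh_eq, abs_div]
    simp only [Complex.mul_re, Complex.neg_re, Complex.neg_im, Complex.I_re, Complex.I_im, mul_zero,
      mul_one, zero_sub, neg_neg] at h2
    rw [Complex.norm_ofNat, abs_of_pos (show (0 : ℝ) < 2 by norm_num)]
    gcongr
  refine le_trans ?_ h1
  rcases le_total 0 z.im with h | h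
  · rw [abs_of_nonneg h]
    exact (Real.self_le_sinh_iff.2 h).trans (le_abs_self _)
  · rw [abs_of_nonpos h]
    have := Real.sinh_le_self_iff.2 h
    exact (neg_le_neg this).trans (neg_le_abs _)

theorem two_pi_mul_im (ν : ℂ) : (2 * Real.pi * ν : ℂ).im = 2 * Real.pi * ν.im := by
  have : (2 * Real.pi * ν : ℂ) = ((2 * Real.pi : ℝ) : ℂ) * ν := by push_cast; ring
  rw [this, Complex.im_ofReal_mul]

theorem countable_zeros_cos_two_pi : {z : ℂ | Complex.cos (2 * Real.pi * z) = 0}.Countable := by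
  refine (Set.countable_range fun k : ℤ => (2 * (k : ℂ) + 1) / 4).mono fun z hz => ?_
  obtain ⟨k, hk⟩ := Complex.cos_eq_zero_iff.1 hz
  refine ⟨k, ?_⟩
  have hpi : (Real.pi : ℂ) ≠ 0 := Complex.ofReal_ne_zero.2 Real.pi_ne_zero
  have h2 : (2 * Real.pi : ℂ) * (z - (2 * (k : ℂ) + 1) / 4) = 0 := by linear_combination hk
  have h3 := (mul_eq_zero.1 h2).resolve_left (mul_ne_zero two_ne_zero hpi)
  exact (sub_eq_zero.1 h3).symm

theorem cos_two_pi_mul_add_int (z : ℂ) (k : ℤ) :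
    Complex.cos (2 * Real.pi * (z + k)) = Complex.cos (2 * Real.pi * z) := by
  rw [← Complex.cos_add_int_mul_two_pi (2 * Real.pi * z) k]
  congr 1; ring

/-- An even entire function of period one which is `O(cos 2πz)` near `±i∞` is an affine function of
`cos 2πz`. -/
theorem exists_eq_add_mul_cos {F : ℂ → ℂ} (hF : Differentiable ℂ F) (hper : ∀ z, F (z + 1) = F z)
    (heven : ∀ z, F (-z) = F z) {C Y : ℝ} (hY : 1 ≤ Y)
    (hbd : ∀ z : ℂ, 0 ≤ z.re → z.re ≤ 1 → Y ≤ |z.im| →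
      ‖F z‖ ≤ C * ‖Complex.cos (2 * Real.pi * z)‖) :
    ∃ c : ℂ, ∀ z, F z = F (1 / 4) + c * Complex.cos (2 * Real.pi * z) := by
  have hperZ : ∀ (z : ℂ) (k : ℤ), F (z + k) = F z := by
    intro z k
    have : Function.Periodic F 1 := hper
    simpa using this.int_mul k z
  have hpi : (Real.pi : ℂ) ≠ 0 := Complex.ofReal_ne_zero.2 Real.pi_ne_zero
  have hder : ∀ z : ℂ, HasDerivAt (fun z : ℂ => Complex.cos (2 * Real.pi * z))
      (-Complex.sin (2 * Real.pi * z) * (2 * Real.pi)) z := by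
    intro z
    have := (hasDerivAt_id z).const_mul (2 * Real.pi : ℂ)
    simpa using this.ccos
  -- The zeros of cos 2πz are simple and lie at ±1/4 modulo 1; there evenness and periodicity give F
  -- the value F(1/4).
  obtain ⟨h, hh, hfh⟩ := exists_differentiable_quotient (f := fun z => F z - F (1 / 4))
    (g := fun z => Complex.cos (2 * Real.pi * z)) (hF.sub_const _)
    (fun z => (hder z).differentiableAt)
    (by
      intro z hz
      obtain ⟨k, hk⟩ := Complex.cos_eq_zero_iff.1 hz
      have h2 : (2 * Real.pi : ℂ) * (z - (2 * (k : ℂ) + 1) / 4) = 0 := by linear_combination hk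
      have h3 := sub_eq_zero.1
        ((mul_eq_zero.1 h2).resolve_left (mul_ne_zero two_ne_zero hpi))
      rcases Int.even_or_odd' k with ⟨j, rfl | rfl⟩
      · rw [sub_eq_zero, h3, ← hperZ (1 / 4) j]
        congr 1; push_cast; ring
      · rw [sub_eq_zero, h3, ← heven (1 / 4), ← hperZ (-(1 / 4)) (j + 1)]
        congr 1; push_cast; ring)
    (by
      intro z hz
      rw [(hder z).deriv]
      have hs : Complex.sin (2 * Real.pi * z) ≠ 0 := by
        intro hs
        have := Complex.sin_sq_add_cos_sq (2 * Real.pi * z)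
        rw [hs, hz] at this
        norm_num at this
      exact mul_ne_zero (neg_ne_zero.2 hs) (mul_ne_zero two_ne_zero hpi))
  have hhper : ∀ (k : ℤ) (z : ℂ), h (z + k) = h z := by
    intro k
    have hdense : Dense {z : ℂ | Complex.cos (2 * Real.pi * z) = 0}ᶜ :=
      countable_zeros_cos_two_pi.dense_compl ℂ
    refine congrFun (Continuous.ext_on hdense (hh.continuous.comp (continuous_add_const _))
      hh.continuous fun z hz => ?_)
    have h1 := hfh (z + k)
    rw [hperZ, cos_two_pi_mul_add_int, hfh z] at h1
    exact (mul_right_cancel₀ hz h1).symm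
  obtain ⟨K, hK⟩ := ((isCompact_Icc (a := (0 : ℝ)) (b := 1)).reProdIm
    (isCompact_Icc (a := -Y) (b := Y))).exists_bound_of_continuousOn hh.continuous.continuousOn
  -- On a period strip the quotient is bounded by compactness for |Im z| ≤ Y and by the growth
  -- hypothesis beyond; periodicity then gives boundedness everywhere.
  have hstrip : ∀ z : ℂ, 0 ≤ z.re → z.re ≤ 1 → ‖h z‖ ≤ max K (C + ‖F (1 / 4)‖) := by
    intro z h0 h1
    rcases le_total |z.im| Y with hy | hy
    · exact (hK z ⟨⟨h0, h1⟩, abs_le.1 hy⟩).trans (le_max_left _ _)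
    · refine le_trans ?_ (le_max_right _ _)
      have hc : 1 ≤ ‖Complex.cos (2 * Real.pi * z)‖ := by
        refine le_trans ?_ (abs_im_le_norm_cos _)
        rw [two_pi_mul_im, abs_mul, abs_of_pos Real.two_pi_pos]
        nlinarith [Real.pi_gt_three]
      have h2 : ‖h z‖ * ‖Complex.cos (2 * Real.pi * z)‖ ≤
          (C + ‖F (1 / 4)‖) * ‖Complex.cos (2 * Real.pi * z)‖ := by
        rw [← norm_mul, ← hfh z, add_mul]
        refine (norm_sub_le _ _).trans (add_le_add (hbd z h0 h1 hy) ?_)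
        exact le_mul_of_one_le_right (norm_nonneg _) hc
      exact le_of_mul_le_mul_right h2 (by linarith)
  have hbounded : Bornology.IsBounded (Set.range h) := by
    refine isBounded_iff_forall_norm_le.2 ⟨max K (C + ‖F (1 / 4)‖), ?_⟩
    rintro _ ⟨z, rfl⟩
    rw [← hhper (-⌊z.re⌋) z]
    refine hstrip _ ?_ ?_
    · rw [Complex.add_re, Complex.intCast_re, Int.cast_neg]
      linarith [Int.floor_le z.re]
    · rw [Complex.add_re, Complex.intCast_re, Int.cast_neg]
      linarith [Int.lt_floor_add_one z.re]
  obtain ⟨c, hc⟩ := hh.exists_const_forall_eq_of_bounded hbounded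
  exact ⟨c, fun z => by rw [← hc z, ← hfh z]; ring⟩

end quotient

/-! ### The regularised determinant as a function of the Floquet exponent -/

section floquet

variable {γ : ℤ → ℂ}

theorem finsetDet_floquetMatrix_add_one (hγ : Summable fun k => ‖γ k‖) (w ν : ℂ) :
    finsetDet (floquetMatrix γ w (ν + 1)) = finsetDet (floquetMatrix γ w ν) := by
  rw [← finsetDet_reindex (floquetMatrix_dominatedBy w ν) (summable_floquet_bound hγ w ν)
    (Equiv.addRight 1)]
  congr 1
  ext n m
  simp only [floquetMatrix, Matrix.submatrix_apply, Matrix.of_apply, Equiv.coe_addRight,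
    add_sub_add_right_eq_sub, add_left_inj]
  push_cast
  rw [show (n : ℂ) + (ν + 1) = n + 1 + ν by ring]

/-- Reflecting the indices moves the diagonal factor to the other side and transposes. The
coefficients γ need not be even, because det(1 + DG) = det(1 + GD). -/
theorem finsetDet_floquetMatrix_neg (hγ : Summable fun k => ‖γ k‖) (w ν : ℂ) :
    finsetDet (floquetMatrix γ w (-ν)) = finsetDet (floquetMatrix γ w ν) := by
  rw [← finsetDet_reindex (floquetMatrix_dominatedBy w (-ν)) (summable_floquet_bound hγ w (-ν))
    (Equiv.neg ℤ)]
  unfold finsetDet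
  congr 1
  funext S
  let G : Matrix S S ℂ := Matrix.of fun n m => γ ((n : ℤ) - m)
  let d : S → ℂ := fun n => (w ^ 2 - (((n : ℤ) : ℂ) + ν) ^ 2)⁻¹
  have h1 : (floquetMatrix γ w ν).submatrix (fun i : S => (i : ℤ)) (fun i : S => (i : ℤ)) =
      1 + Matrix.diagonal d * G := by
    ext n m
    simp only [floquetMatrix, Matrix.submatrix_apply, Matrix.of_apply, Matrix.add_apply,
      Matrix.diagonal_mul, Matrix.one_apply, G, d, Subtype.coe_inj]
    ring
  have h2 : ((floquetMatrix γ w (-ν)).submatrix (Equiv.neg ℤ) (Equiv.neg ℤ)).submatrix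
      (fun i : S => (i : ℤ)) (fun i : S => (i : ℤ)) = (1 + G * Matrix.diagonal d).transpose := by
    ext n m
    simp only [floquetMatrix, Matrix.submatrix_apply, Matrix.of_apply, Matrix.transpose_apply,
      Matrix.add_apply, Matrix.mul_diagonal, Matrix.one_apply, G, d, Equiv.neg_apply, neg_inj,
      Subtype.coe_inj]
    rw [show -(n : ℤ) - -(m : ℤ) = m - n by ring]
    push_cast
    rw [show (-((n : ℤ) : ℂ) + -ν) ^ 2 = (((n : ℤ) : ℂ) + ν) ^ 2 by ring, div_eq_mul_inv, add_comm]
    congr 1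
    simp only [eq_comm]
  rw [detOn, detOn, h1, h2, Matrix.det_transpose, Matrix.det_one_add_mul_comm]

/-- Periodicity and evenness of the entire determinant are read off from the Floquet determinant
away from the poles and extended by continuity. -/
theorem dense_nonpoles (w : ℂ) : Dense {ν : ℂ | ∀ n : ℤ, w ^ 2 - ((n : ℂ) + ν) ^ 2 ≠ 0} := by
  have h : (⋃ n : ℤ, ({w - n, -w - n} : Set ℂ)).Countable :=
    Set.countable_iUnion fun n => (Set.toFinite _).countable
  refine (h.dense_compl ℂ).mono ?_
  intro ν hν n hn
  refine hν ?_
  have h1 : (w - n - ν) * (w + n + ν) = 0 := by linear_combination hn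
  refine Set.mem_iUnion.2 ⟨n, ?_⟩
  rcases mul_eq_zero.1 h1 with h1 | h1
  · left; linear_combination -h1
  · right; rw [Set.mem_singleton_iff]; linear_combination h1

theorem sin_mul_sin_pi (w ν : ℂ) :
    Complex.sin (Real.pi * (ν - w)) * Complex.sin (Real.pi * (ν + w)) =
      (Complex.cos (2 * Real.pi * w) - Complex.cos (2 * Real.pi * ν)) / 2 := by
  have h1 : (2 * Real.pi * w : ℂ) = Real.pi * (ν + w) - Real.pi * (ν - w) := by ring
  have h2 : (2 * Real.pi * ν : ℂ) = Real.pi * (ν + w) + Real.pi * (ν - w) := by ring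
  rw [h1, h2, Complex.cos_sub, Complex.cos_add]
  ring

theorem regularDet_eq (hγ : Summable fun k => ‖γ k‖) (w ν : ℂ)
    (hν : ∀ n : ℤ, w ^ 2 - ((n : ℂ) + ν) ^ 2 ≠ 0) :
    regularDet γ w ν = (Complex.cos (2 * Real.pi * ν) - Complex.cos (2 * Real.pi * w)) *
      finsetDet (floquetMatrix γ w ν) / (2 * Real.pi ^ 2) := by
  have h := sin_mul_sin_mul_finsetDet hγ w ν hν
  rw [sin_mul_sin_pi] at h
  have hpi : (Real.pi : ℂ) ≠ 0 := Complex.ofReal_ne_zero.2 Real.pi_ne_zero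
  field_simp
  linear_combination 2 * h

theorem regularDet_add_one (hγ : Summable fun k => ‖γ k‖) (w ν : ℂ) :
    regularDet γ w (ν + 1) = regularDet γ w ν := by
  have hc := (differentiable_regularDet hγ w).continuous
  refine congrFun (Continuous.ext_on (f := fun ν => regularDet γ w (ν + 1)) (dense_nonpoles w)
    (hc.comp (continuous_add_const _)) hc fun ν hν => ?_) ν
  have hν' : ∀ n : ℤ, w ^ 2 - ((n : ℂ) + (ν + 1)) ^ 2 ≠ 0 := by
    intro n
    have := hν (n + 1)
    rwa [Int.cast_add, Int.cast_one, show (n : ℂ) + 1 + ν = n + (ν + 1) by ring] at this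
  have hcos := cos_two_pi_mul_add_int ν 1
  rw [Int.cast_one] at hcos
  simp only
  rw [regularDet_eq hγ w _ hν', regularDet_eq hγ w _ hν, finsetDet_floquetMatrix_add_one hγ, hcos]

theorem regularDet_neg (hγ : Summable fun k => ‖γ k‖) (w ν : ℂ) :
    regularDet γ w (-ν) = regularDet γ w ν := by
  have hc := (differentiable_regularDet hγ w).continuous
  refine congrFun (Continuous.ext_on (f := fun ν => regularDet γ w (-ν)) (dense_nonpoles w)
    (hc.comp continuous_neg) hc fun ν hν => ?_) ν
  have hν' : ∀ n : ℤ, w ^ 2 - ((n : ℂ) + -ν) ^ 2 ≠ 0 := by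
    intro n
    have := hν (-n)
    rwa [Int.cast_neg, show (-(n : ℂ) + ν) ^ 2 = (n + -ν) ^ 2 by ring] at this
  simp only
  rw [regularDet_eq hγ w _ hν', regularDet_eq hγ w _ hν, finsetDet_floquetMatrix_neg hγ, mul_neg,
    Complex.cos_neg]

/-- Each of the factors n + ν ∓ w has at least half the modulus of n + ν, because |Im ν| ≥ 2|w|. The
bound is uniform over the period strip. -/
theorem le_norm_sq_sub_sq {w ν : ℂ} (h0 : 0 ≤ ν.re) (h1 : ν.re ≤ 1)
    (hw : 2 + 2 * ‖w‖ ≤ |ν.im|) (n : ℤ) :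
    ((n : ℝ) ^ 2 + ν.im ^ 2) / 8 ≤ ‖w ^ 2 - ((n : ℂ) + ν) ^ 2‖ := by
  have hw0 := norm_nonneg w
  have hy : |ν.im| ≤ ‖(n : ℂ) + ν‖ := by
    have := Complex.abs_im_le_norm ((n : ℂ) + ν)
    simpa using this
  have ha : ‖(n : ℂ) + ν‖ / 2 ≤ ‖(n : ℂ) + ν - w‖ := by
    have := norm_sub_norm_le ((n : ℂ) + ν) w
    linarith
  have hb : ‖(n : ℂ) + ν‖ / 2 ≤ ‖(n : ℂ) + ν + w‖ := by
    have := norm_sub_norm_le ((n : ℂ) + ν) (-w)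
    rw [norm_neg, sub_neg_eq_add] at this
    linarith
  have hsq : ‖(n : ℂ) + ν‖ ^ 2 = ((n : ℝ) + ν.re) ^ 2 + ν.im ^ 2 := by
    rw [← Complex.normSq_eq_norm_sq, Complex.normSq_apply]
    simp; ring
  have hy2 : 4 ≤ ν.im ^ 2 := by
    rw [← sq_abs]; nlinarith
  have h3 : w ^ 2 - ((n : ℂ) + ν) ^ 2 = -(((n : ℂ) + ν - w) * ((n : ℂ) + ν + w)) := by ring
  rw [h3, norm_neg, norm_mul]
  calc ((n : ℝ) ^ 2 + ν.im ^ 2) / 8 ≤ (‖(n : ℂ) + ν‖ / 2) * (‖(n : ℂ) + ν‖ / 2) := by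
        have : (‖(n : ℂ) + ν‖ / 2) * (‖(n : ℂ) + ν‖ / 2) = ‖(n : ℂ) + ν‖ ^ 2 / 4 := by ring
        rw [this, hsq]
        -- With x = Re ν and y = Im ν, the claim reduces to (n + 2x)² + y² − 2x² ≥ 0, which holds
        -- since 0 ≤ x ≤ 1 and y² ≥ 4.
        nlinarith [sq_nonneg ((n : ℝ) + 2 * ν.re)]
    _ ≤ _ := mul_le_mul ha hb (by positivity) (norm_nonneg _)

theorem summable_inv_sq_add_sq {y : ℝ} (hy : 1 ≤ |y|) :
    Summable fun n : ℤ => ((n : ℝ) ^ 2 + y ^ 2)⁻¹ := by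
  refine Summable.of_nonneg_of_le (fun n => by positivity) (fun n => ?_)
    summable_inv_one_add_sq_int
  have : 1 ≤ y ^ 2 := by rw [← sq_abs]; nlinarith
  exact inv_anti₀ (by positivity) (by linarith)

theorem norm_finsetDet_floquetMatrix_sub_one_le (hγ : Summable fun k => ‖γ k‖) {w ν : ℂ}
    (h0 : 0 ≤ ν.re) (h1 : ν.re ≤ 1) (hw : 2 + 2 * ‖w‖ ≤ |ν.im|) :
    ‖finsetDet (floquetMatrix γ w ν) - 1‖ ≤
      (8 * (∑' n : ℤ, ((n : ℝ) ^ 2 + ν.im ^ 2)⁻¹) * ∑' k, ‖γ k‖) *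
        Real.exp (8 * (∑' n : ℤ, ((n : ℝ) ^ 2 + ν.im ^ 2)⁻¹) * ∑' k, ‖γ k‖) := by
  have hy : 1 ≤ |ν.im| := by linarith [norm_nonneg w]
  have hy2 : 0 < ν.im ^ 2 := by rw [← sq_abs]; positivity
  have hu := (summable_inv_sq_add_sq hy).mul_left 8
  have hu0 : ∀ n : ℤ, (0 : ℝ) ≤ 8 * ((n : ℝ) ^ 2 + ν.im ^ 2)⁻¹ := fun n => by positivity
  have hsum := summable_mul_sub (v := fun k => ‖γ k‖) hu hγ hu0 fun k => norm_nonneg _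
  have hts := tsum_mul_sub (v := fun k => ‖γ k‖) hu hγ hu0 fun k => norm_nonneg _
  have hdom : DominatedBy (floquetMatrix γ w ν)
      (fun p => (8 * ((p.1 : ℝ) ^ 2 + ν.im ^ 2)⁻¹) * ‖γ (p.1 - p.2)‖) := by
    intro i j
    refine (floquetMatrix_dominatedBy w ν i j).trans ?_
    simp only
    gcongr
    have h2 := le_norm_sq_sub_sq h0 h1 hw i
    rw [norm_inv, ← div_eq_mul_inv, ← inv_div]
    exact inv_anti₀ (by positivity) h2
  have := norm_finsetDet_sub_one_le hdom hsum
  rwa [hts, tsum_mul_left] at this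

theorem tendsto_tsum_inv_sq_add_sq :
    Tendsto (fun y : ℝ => ∑' n : ℤ, ((n : ℝ) ^ 2 + y ^ 2)⁻¹) atTop (𝓝 0) := by
  have h := tendsto_tsum_of_dominated_convergence (𝓕 := (atTop : Filter ℝ))
    (f := fun (y : ℝ) (n : ℤ) => ((n : ℝ) ^ 2 + y ^ 2)⁻¹) (g := fun _ => (0 : ℝ))
    summable_inv_one_add_sq_int
    (fun n => by
      refine Tendsto.inv_tendsto_atTop ?_
      exact tendsto_atTop_add_const_left _ _ (tendsto_pow_atTop two_ne_zero))
    (by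
      filter_upwards [eventually_ge_atTop (1 : ℝ)] with y hy n
      have : 1 ≤ y ^ 2 := by nlinarith
      rw [Real.norm_of_nonneg (by positivity)]
      exact inv_anti₀ (by positivity) (by linarith))
  simpa using h

/-- High in the period strip the Floquet determinant is bounded by a constant, so the factor cos 2πν
− cos 2πw alone governs the growth. -/
theorem exists_regularDet_eq_add_mul_cos (hγ : Summable fun k => ‖γ k‖) (w : ℂ) :
    ∃ c : ℂ, ∀ ν, regularDet γ w ν = regularDet γ w (1 / 4) + c * Complex.cos (2 * Real.pi * ν) := by
  set B : ℝ := 8 * (∑' n : ℤ, (1 + (n : ℝ) ^ 2)⁻¹) * ∑' k, ‖γ k‖ with hB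
  have hB0 : 0 ≤ B := mul_nonneg (mul_nonneg (by norm_num) (tsum_nonneg fun n => by positivity))
    (tsum_nonneg fun k => norm_nonneg _)
  refine exists_eq_add_mul_cos (differentiable_regularDet hγ w) (regularDet_add_one hγ w)
    (regularDet_neg hγ w) (Y := 2 + 2 * ‖w‖)
    (C := (1 + ‖Complex.cos (2 * Real.pi * w)‖) * (1 + B * Real.exp B))
    (by linarith [norm_nonneg w]) fun ν h0 h1 hw => ?_
  have hy : 1 ≤ |ν.im| := by linarith [norm_nonneg w]
  have hy2 : 1 ≤ ν.im ^ 2 := by rw [← sq_abs]; nlinarith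
  have hne : ∀ n : ℤ, w ^ 2 - ((n : ℂ) + ν) ^ 2 ≠ 0 := fun n =>
    norm_pos_iff.1 (lt_of_lt_of_le (by positivity) (le_norm_sq_sub_sq h0 h1 hw n))
  have hD := norm_finsetDet_floquetMatrix_sub_one_le hγ h0 h1 hw
  have hT : 8 * (∑' n : ℤ, ((n : ℝ) ^ 2 + ν.im ^ 2)⁻¹) * ∑' k, ‖γ k‖ ≤ B := by
    rw [hB]
    have : 0 ≤ ∑' k, ‖γ k‖ := tsum_nonneg fun k => norm_nonneg _
    have : ∑' n : ℤ, ((n : ℝ) ^ 2 + ν.im ^ 2)⁻¹ ≤ ∑' n : ℤ, (1 + (n : ℝ) ^ 2)⁻¹ :=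
      (summable_inv_sq_add_sq hy).tsum_le_tsum
        (fun n => inv_anti₀ (by positivity) (by linarith)) summable_inv_one_add_sq_int
    gcongr
  have hD1 : ‖finsetDet (floquetMatrix γ w ν)‖ ≤ 1 + B * Real.exp B := by
    have h2 : ‖finsetDet (floquetMatrix γ w ν) - 1‖ ≤ B * Real.exp B := hD.trans (by gcongr)
    have h3 := norm_le_norm_add_norm_sub' (finsetDet (floquetMatrix γ w ν)) 1
    rw [norm_one] at h3
    linarith
  have hc : 1 ≤ ‖Complex.cos (2 * Real.pi * ν)‖ := by
    refine le_trans ?_ (abs_im_le_norm_cos _)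
    rw [two_pi_mul_im, abs_mul, abs_of_pos Real.two_pi_pos]
    nlinarith [Real.pi_gt_three]
  have hcc : ‖Complex.cos (2 * Real.pi * ν) - Complex.cos (2 * Real.pi * w)‖ ≤
      (1 + ‖Complex.cos (2 * Real.pi * w)‖) * ‖Complex.cos (2 * Real.pi * ν)‖ := by
    refine (norm_sub_le _ _).trans ?_
    nlinarith [norm_nonneg (Complex.cos (2 * Real.pi * w))]
  have hpi : 1 ≤ ‖(2 * (Real.pi : ℂ) ^ 2)‖ := by
    rw [norm_mul, norm_pow, Complex.norm_real, Complex.norm_ofNat, Real.norm_of_nonneg Real.pi_pos.le]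
    nlinarith [Real.pi_gt_three]
  rw [regularDet_eq hγ w ν hne, norm_div, norm_mul]
  refine (div_le_self (by positivity) hpi).trans ?_
  calc _ ≤ ((1 + ‖Complex.cos (2 * Real.pi * w)‖) * ‖Complex.cos (2 * Real.pi * ν)‖) *
        (1 + B * Real.exp B) := by gcongr
    _ = _ := by ring

/-- The regularised determinant is an explicit function of the exponent, up to a constant. -/
theorem regularDet_sub_regularDet (hγ : Summable fun k => ‖γ k‖) (w ν ν' : ℂ) :
    regularDet γ w ν - regularDet γ w ν' =
      (Complex.cos (2 * Real.pi * ν) - Complex.cos (2 * Real.pi * ν')) / (2 * Real.pi ^ 2) := by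
  obtain ⟨c, hc⟩ := exists_regularDet_eq_add_mul_cos hγ w
  set u : ℝ → ℂ := fun y => Complex.cos (2 * Real.pi * (y * Complex.I)) with hu
  have hulim : Tendsto (fun y => (u y)⁻¹) atTop (𝓝 0) := by
    refine tendsto_inv₀_cobounded.comp (tendsto_norm_atTop_iff_cobounded.1 ?_)
    refine tendsto_atTop_mono' _ ?_ tendsto_id
    filter_upwards [eventually_ge_atTop (0 : ℝ)] with y hy
    refine le_trans ?_ (abs_im_le_norm_cos _)
    rw [two_pi_mul_im, abs_mul, abs_of_pos Real.two_pi_pos]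
    simp only [Complex.mul_im, Complex.ofReal_re, Complex.I_im, Complex.ofReal_im, Complex.I_re,
      mul_one, mul_zero, add_zero, abs_of_nonneg hy, id]
    nlinarith [Real.pi_gt_three]
  have hDlim : Tendsto (fun y : ℝ => finsetDet (floquetMatrix γ w (y * Complex.I))) atTop (𝓝 1) := by
    rw [tendsto_iff_norm_sub_tendsto_zero]
    have h1 : Tendsto (fun y : ℝ => 8 * (∑' n : ℤ, ((n : ℝ) ^ 2 + y ^ 2)⁻¹) * ∑' k, ‖γ k‖) atTop
        (𝓝 0) := by
      simpa using (tendsto_tsum_inv_sq_add_sq.const_mul 8).mul_const (∑' k, ‖γ k‖)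
    have h2 := h1.mul ((Real.continuous_exp.tendsto 0).comp h1)
    rw [zero_mul] at h2
    refine squeeze_zero' (Eventually.of_forall fun y => norm_nonneg _) ?_ h2
    filter_upwards [eventually_ge_atTop (2 + 2 * ‖w‖)] with y hy
    have := norm_finsetDet_floquetMatrix_sub_one_le hγ (w := w) (ν := y * Complex.I) (by simp)
      (by simp) (by simpa using hy.trans (le_abs_self y))
    simpa using this
  -- For large y this expression, divided by 1, is the slope c: it results from solving the affine
  -- identity at ν = iy for c.
  have hclim : Tendsto (fun y : ℝ => (1 - Complex.cos (2 * Real.pi * w) * (u y)⁻¹) *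
      finsetDet (floquetMatrix γ w (y * Complex.I)) / (2 * Real.pi ^ 2) -
        regularDet γ w (1 / 4) * (u y)⁻¹) atTop (𝓝 (1 / (2 * (Real.pi : ℂ) ^ 2))) := by
    have := ((((hulim.const_mul (Complex.cos (2 * Real.pi * w))).const_sub 1).mul hDlim).div_const
      (2 * (Real.pi : ℂ) ^ 2)).sub (hulim.const_mul (regularDet γ w (1 / 4)))
    simpa using this
  have hceq : c = 1 / (2 * (Real.pi : ℂ) ^ 2) := by
    refine tendsto_nhds_unique (tendsto_const_nhds.congr' ?_) hclim
    filter_upwards [eventually_ge_atTop (2 + 2 * ‖w‖), eventually_gt_atTop (0 : ℝ)] with y hy hy0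
    have hne : ∀ n : ℤ, w ^ 2 - ((n : ℂ) + y * Complex.I) ^ 2 ≠ 0 := fun n =>
      norm_pos_iff.1 (lt_of_lt_of_le (by simp; positivity)
        (le_norm_sq_sub_sq (ν := y * Complex.I) (by simp) (by simp)
          (by simpa using hy.trans (le_abs_self y)) n))
    have h1 := hc (y * Complex.I)
    have hu0 : u y ≠ 0 := by
      refine norm_pos_iff.1 (lt_of_lt_of_le ?_ (abs_im_le_norm_cos _))
      rw [two_pi_mul_im]
      have := Real.pi_pos
      simp; positivity
    rw [regularDet_eq hγ w _ hne] at h1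
    change (u y - _) * _ / _ = _ + c * u y at h1
    have hpi : (Real.pi : ℂ) ≠ 0 := Complex.ofReal_ne_zero.2 Real.pi_ne_zero
    field_simp at h1 ⊢
    linear_combination -h1
  rw [hc ν, hc ν', hceq]
  ring

/-- If the Floquet system is singular for the exponent `ν`, the determinant for the exponent `0` is
determined by `cos 2πν`. -/
theorem two_mul_cos_eq_of_regularDet_eq_zero (hγ : Summable fun k => ‖γ k‖) (w ν : ℂ)
    (hw : ∀ n : ℤ, w ^ 2 ≠ (n : ℂ) ^ 2) (hν : regularDet γ w ν = 0) :
    2 * Complex.cos (2 * Real.pi * ν) =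
      2 - 4 * finsetDet (floquetMatrix γ w 0) * Complex.sin (Real.pi * w) ^ 2 := by
  have h1 := regularDet_sub_regularDet hγ w 0 ν
  have h2 := sin_mul_sin_mul_finsetDet hγ w 0 fun n => by
    rw [add_zero]; exact sub_ne_zero.2 (hw n)
  rw [hν, sub_zero, mul_zero, Complex.cos_zero] at h1
  have hpi : (Real.pi : ℂ) ≠ 0 := Complex.ofReal_ne_zero.2 Real.pi_ne_zero
  have h3 : (Real.pi : ℂ) ^ 2 * regularDet γ w 0 = (1 - Complex.cos (2 * Real.pi * ν)) / 2 := by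
    rw [h1]; field_simp
  rw [h3, zero_sub, zero_add, mul_neg, Complex.sin_neg] at h2
  linear_combination -4 * h2

end floquet

/-! ### The Fourier series of the potential -/

section potential

/-- If |s| = 1 then 1/s is the conjugate of s, so c = Re s lies in [−1, 1], which is excluded unless
c = 0. -/
theorem norm_lt_one_or_sq_eq_neg_one {c s : ℂ}
    (hc : ∀ x : ℝ, x ∈ Set.Ico (-1 : ℝ) 0 ∪ Set.Ioc (0 : ℝ) 1 → c ≠ (x : ℂ))
    (hs0 : s ≠ 0) (hs1 : ‖s‖ ≤ 1) (hcs : c = (s + 1 / s) / 2) :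
    (c ≠ 0 ∧ ‖s‖ < 1) ∨ (c = 0 ∧ s ^ 2 = -1) := by
  by_cases h0 : c = 0
  · right
    refine ⟨h0, ?_⟩
    rw [h0] at hcs
    field_simp at hcs
    linear_combination -hcs
  · left
    refine ⟨h0, lt_of_le_of_ne hs1 fun h1 => ?_⟩
    have h2 : 1 / s = (starRingEnd ℂ) s := by
      rw [one_div]; exact Complex.inv_eq_conj h1
    have h3 : c = (s.re : ℂ) := by
      rw [hcs, h2, Complex.add_conj]; push_cast; ring
    have h4 := abs_le.1 ((Complex.abs_re_le_norm s).trans hs1)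
    have h5 : s.re ≠ 0 := by
      intro h; rw [h] at h3; exact h0 (by simpa using h3)
    refine hc s.re ?_ h3
    rcases lt_or_gt_of_ne h5 with h | h
    · exact Or.inl ⟨h4.1, h⟩
    · exact Or.inr ⟨h, h4.2⟩

theorem hillKappa_eq_zero {s : ℂ} (h : s ^ 2 = -1) : hillKappa s = 0 := by
  simp [hillKappa, h]

theorem hillG_eq (s : ℂ) (k : ℤ) :
    hillG s k = (if k = 0 then 1 else 0) + hillKappa s * (Complex.I ^ k * s ^ k.natAbs) := by
  unfold hillG
  split_ifs with h
  · subst h; simp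
  · ring

/-- For s² = −1 the geometric series is unavailable, but then κ = 0 and only g_0 = 1 survives. -/
theorem summable_norm_hillG {s : ℂ} (h : ‖s‖ < 1 ∨ s ^ 2 = -1) :
    Summable fun k : ℤ => ‖hillG s k‖ := by
  have h1 : Summable fun k : ℤ => ‖(if k = 0 then (1 : ℂ) else 0)‖ :=
    summable_of_ne_finset_zero (s := {0}) fun k hk => by
      rw [Finset.mem_singleton] at hk; simp [hk]
  have h2 : Summable fun k : ℤ => ‖hillKappa s * (Complex.I ^ k * s ^ k.natAbs)‖ := by
    rcases h with h | h
    · simp only [norm_mul, norm_zpow, Complex.norm_I, one_zpow, one_mul, norm_pow]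
      refine Summable.mul_left _ (Summable.of_nat_of_neg ?_ ?_) <;>
        simpa using summable_geometric_of_lt_one (norm_nonneg s) h
    · simp [hillKappa_eq_zero h]
  refine Summable.of_nonneg_of_le (fun k => norm_nonneg _) (fun k => ?_) (h1.add h2)
  rw [hillG_eq]
  exact norm_add_le _ _

/-- With z = e^{iη}, a = isz and b = s/(iz), the terms k ≥ 0 and k < 0 are geometric series in a and
b. Moreover ab = s², and the denominator is (1 − a)(1 − b). -/
theorem hasSum_poisson {s : ℂ} (hs : ‖s‖ < 1) (η : ℝ) :
    HasSum (fun k : ℤ => Complex.I ^ k * s ^ k.natAbs * Complex.exp (Complex.I * k * η))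
      ((1 - s ^ 2) / (1 + s ^ 2 + 2 * s * Complex.sin η)) ∧
      1 + s ^ 2 + 2 * s * Complex.sin η ≠ 0 := by
  set z : ℂ := Complex.exp (Complex.I * η) with hz
  have hz0 : z ≠ 0 := Complex.exp_ne_zero _
  have hzn : ‖z‖ = 1 := by rw [hz, mul_comm, Complex.norm_exp_ofReal_mul_I]
  have hexp : ∀ k : ℤ, Complex.exp (Complex.I * k * η) = z ^ k := by
    intro k
    rw [hz, ← Complex.exp_int_mul]; congr 1; ring
  have hzinv : Complex.exp (-(Complex.I * η)) = z⁻¹ := by rw [Complex.exp_neg]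
  have hsin : Complex.sin η = (z⁻¹ - z) * Complex.I / 2 := by
    rw [Complex.sin, ← hzinv, hz, mul_comm Complex.I, neg_mul]
  set a : ℂ := Complex.I * s * z with ha
  set b : ℂ := s * (Complex.I * z)⁻¹ with hb
  have han : ‖a‖ < 1 := by simpa [ha, hzn] using hs
  have hbn : ‖b‖ < 1 := by simpa [hb, hzn] using hs
  have ha1 : 1 - a ≠ 0 := by
    intro h
    rw [sub_eq_zero] at h
    rw [← h, norm_one] at han
    exact lt_irrefl _ han
  have hb1 : 1 - b ≠ 0 := by
    intro h
    rw [sub_eq_zero] at h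
    rw [← h, norm_one] at hbn
    exact lt_irrefl _ hbn
  have hden : 1 + s ^ 2 + 2 * s * Complex.sin η = (1 - a) * (1 - b) := by
    rw [hsin, ha, hb, mul_inv, Complex.inv_I]
    field_simp
    linear_combination (s ^ 2 * z) * Complex.I_sq
  have hI : Complex.I ≠ 0 := Complex.I_ne_zero
  refine ⟨?_, hden ▸ mul_ne_zero ha1 hb1⟩
  have h1 : HasSum (fun n : ℕ => Complex.I ^ (n : ℤ) * s ^ (n : ℤ).natAbs *
      Complex.exp (Complex.I * (n : ℤ) * η)) (1 - a)⁻¹ := by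
    refine (hasSum_geometric_of_norm_lt_one han).congr_fun ?_
    intro n
    rw [hexp, ha]
    simp only [zpow_natCast, Int.natAbs_natCast]
    rw [mul_pow, mul_pow]
  have h2 : HasSum (fun n : ℕ => Complex.I ^ (-((n : ℤ) + 1)) * s ^ (-((n : ℤ) + 1)).natAbs *
      Complex.exp (Complex.I * (-((n : ℤ) + 1) : ℤ) * η)) (b * (1 - b)⁻¹) := by
    refine ((hasSum_geometric_of_norm_lt_one hbn).mul_left b).congr_fun ?_
    intro n
    have h3 : (-((n : ℤ) + 1)).natAbs = n + 1 := by omega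
    rw [hexp, h3, ← pow_succ', hb, mul_pow, inv_pow, mul_pow, zpow_neg, zpow_neg, mul_inv]
    norm_cast
    ring
  convert HasSum.of_nat_of_neg_add_one (f := fun k : ℤ => Complex.I ^ k * s ^ k.natAbs *
    Complex.exp (Complex.I * k * η)) h1 h2 using 1
  rw [hden]
  have hab : a * b = s ^ 2 := by rw [ha, hb]; field_simp
  field_simp
  linear_combination hab

theorem hasSum_hillPotential {c s : ℂ}
    (hc : ∀ x : ℝ, x ∈ Set.Ico (-1 : ℝ) 0 ∪ Set.Ioc (0 : ℝ) 1 → c ≠ (x : ℂ))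
    (hs0 : s ≠ 0) (hs1 : ‖s‖ ≤ 1) (hcs : c = (s + 1 / s) / 2) (η : ℝ) :
    HasSum (fun k : ℤ => hillG s k * Complex.exp (Complex.I * (k : ℂ) * (η : ℂ)))
      (hillPotential c η) := by
  have h0 : HasSum (fun k : ℤ => (if k = 0 then (1 : ℂ) else 0) *
      Complex.exp (Complex.I * (k : ℂ) * (η : ℂ))) 1 := by
    have := hasSum_ite_eq (0 : ℤ) (1 : ℂ)
    refine this.congr_fun fun k => ?_
    split_ifs with h
    · subst h; simp
    · simp
  simp only [hillG_eq, add_mul]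
  rcases norm_lt_one_or_sq_eq_neg_one hc hs0 hs1 hcs with ⟨hc0, hs⟩ | ⟨hc0, hs⟩
  · obtain ⟨h1, hne⟩ := hasSum_poisson hs η
    have h2 := h0.add (h1.mul_left (hillKappa s))
    have h3 : hillPotential c η =
        1 + hillKappa s * ((1 - s ^ 2) / (1 + s ^ 2 + 2 * s * Complex.sin η)) := by
      have hs2 : 1 - s ^ 2 ≠ 0 := by
        intro h
        have h4 : ‖s‖ ^ 2 = 1 := by
          rw [← norm_pow, show s ^ 2 = 1 by linear_combination -h, norm_one]
        nlinarith [norm_nonneg s]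
      have hc2 : 2 * s * c = s ^ 2 + 1 := by rw [hcs]; field_simp
      have h5 : c + Complex.sin η ≠ 0 := by
        intro h
        apply hne
        linear_combination 2 * s * h - hc2
      have h6 : 1 + s ^ 2 + 2 * s * Complex.sin η = 2 * s * (c + Complex.sin η) := by
        linear_combination -hc2
      have h7 : 1 + s ^ 2 = 2 * s * c := by linear_combination -hc2
      rw [hillPotential, if_neg hc0, hillKappa, Complex.ofReal_sin, h6, h7]
      field_simp
      ring
    rw [h3]
    refine h2.congr_fun fun k => ?_
    ring
  · rw [hillKappa_eq_zero hs, hillPotential, if_pos hc0]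
    simpa using h0

end potential

/-! ### Fourier coefficients by termwise integration -/

section integrals

/-- Termwise integration of an absolutely convergent Fourier series against a function. -/
theorem hasSum_integral_fourier_mul {Q : ℝ → ℂ} {g : ℤ → ℂ} (hg : Summable fun k => ‖g k‖)
    (hQ : ∀ η : ℝ, HasSum (fun k : ℤ => g k * Complex.exp (Complex.I * k * η)) (Q η))
    {f : ℝ → ℂ} (hf : Continuous f) (a b : ℝ) :
    HasSum (fun k : ℤ => g k * ∫ η in a..b, Complex.exp (Complex.I * k * η) * f η)
      (∫ η in a..b, Q η * f η) := by
  simp only [← intervalIntegral.integral_const_mul]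
  refine intervalIntegral.hasSum_integral_of_dominated_convergence
    (fun k η => ‖g k‖ * ‖f η‖) (fun k => ?_) (fun k => ?_) ?_ ?_ ?_
  · exact Continuous.aestronglyMeasurable (by fun_prop)
  · refine Eventually.of_forall fun η _ => ?_
    have : Complex.I * k * η = ((k * η : ℝ) : ℂ) * Complex.I := by push_cast; ring
    rw [norm_mul, norm_mul, this, Complex.norm_exp_ofReal_mul_I, one_mul]
  · exact Eventually.of_forall fun η _ => hg.mul_right _
  · simp only [tsum_mul_right]
    exact Continuous.intervalIntegrable (by fun_prop) _ _
  · refine Eventually.of_forall fun η _ => ?_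
    simpa only [mul_assoc] using (hQ η).mul_right (f η)

theorem integral_exp_int (k : ℤ) :
    ∫ η in (0 : ℝ)..2 * Real.pi, Complex.exp (Complex.I * k * η) =
      if k = 0 then 2 * (Real.pi : ℂ) else 0 := by
  split_ifs with h
  · subst h; simp
  · rw [integral_exp_mul_complex (mul_ne_zero Complex.I_ne_zero (Int.cast_ne_zero.2 h))]
    have : Complex.I * k * (2 * Real.pi : ℝ) = k * (2 * Real.pi * Complex.I) := by push_cast; ring
    rw [this, Complex.exp_int_mul_two_pi_mul_I]
    simp

theorem hillFourier_eq_integral (Q : ℝ → ℂ) (n : ℤ) :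
    hillFourier Q n = (2 * Real.pi : ℂ)⁻¹ *
      ∫ η in (0 : ℝ)..2 * Real.pi, Q η * Complex.exp (-(Complex.I * n * η)) := by
  rw [hillFourier, fourierCoeffOn_eq_integral, Complex.real_smul]
  congr 1
  · push_cast; simp
  · refine intervalIntegral.integral_congr fun η _ => ?_
    simp only [fourier_coe_apply, smul_eq_mul]
    rw [mul_comm]
    congr 2
    have hpi : (Real.pi : ℂ) ≠ 0 := Complex.ofReal_ne_zero.2 Real.pi_ne_zero
    push_cast
    field_simp
    ring

/-- The Fourier coefficients of an absolutely convergent Fourier series. -/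
theorem hillFourier_of_hasSum {Q : ℝ → ℂ} {g : ℤ → ℂ} (hg : Summable fun k => ‖g k‖)
    (hQ : ∀ η : ℝ, HasSum (fun k : ℤ => g k * Complex.exp (Complex.I * k * η)) (Q η)) (n : ℤ) :
    hillFourier Q n = g n := by
  have h1 := hasSum_integral_fourier_mul hg hQ
    (f := fun η => Complex.exp (-(Complex.I * n * η))) (by fun_prop) 0 (2 * Real.pi)
  have h2 : ∀ k : ℤ, ∫ η in (0 : ℝ)..2 * Real.pi, Complex.exp (Complex.I * k * η) *
      Complex.exp (-(Complex.I * n * η)) = if k = n then 2 * (Real.pi : ℂ) else 0 := by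
    intro k
    rw [show (if k = n then (2 * Real.pi : ℂ) else 0) = if k - n = 0 then 2 * (Real.pi : ℂ) else 0 by
      simp only [sub_eq_zero], ← integral_exp_int]
    refine intervalIntegral.integral_congr fun η _ => ?_
    rw [← Complex.exp_add]
    congr 1; push_cast; ring
  simp only [h2] at h1
  have h3 := h1.unique (hasSum_single n fun k hk => by rw [if_neg hk, mul_zero])
  rw [hillFourier_eq_integral, h3, if_pos rfl]
  have hpi : (Real.pi : ℂ) ≠ 0 := Complex.ofReal_ne_zero.2 Real.pi_ne_zero
  field_simp

theorem continuous_of_hasSum_fourier {Q : ℝ → ℂ} {g : ℤ → ℂ} (hg : Summable fun k => ‖g k‖)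
    (hQ : ∀ η : ℝ, HasSum (fun k : ℤ => g k * Complex.exp (Complex.I * k * η)) (Q η)) :
    Continuous Q ∧ ∀ η, ‖Q η‖ ≤ ∑' k, ‖g k‖ := by
  have hb : ∀ (k : ℤ) (η : ℝ), ‖g k * Complex.exp (Complex.I * k * η)‖ ≤ ‖g k‖ := by
    intro k η
    have : Complex.I * k * η = ((k * η : ℝ) : ℂ) * Complex.I := by push_cast; ring
    rw [norm_mul, this, Complex.norm_exp_ofReal_mul_I, mul_one]
  refine ⟨?_, fun η => ?_⟩
  · have h1 := continuous_tsum (f := fun (k : ℤ) (η : ℝ) => g k * Complex.exp (Complex.I * k * η))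
      (fun k => by fun_prop) hg hb
    simpa only [(hQ _).tsum_eq] using h1
  · rw [← (hQ η).tsum_eq]
    exact tsum_of_norm_bounded hg.hasSum fun k => hb k η

end integrals

/-! ### Linear differential equations: the Dyson series -/

section LinearODE

variable {E : Type*} [NormedAddCommGroup E] [NormedSpace ℝ E]

theorem norm_integral_le_of_norm_le_mul_pow {f : ℝ → E} {C : ℝ} {k : ℕ}
    (hf : ∀ s, ‖f s‖ ≤ C * |s| ^ k) (t : ℝ) :
    ‖∫ s in (0 : ℝ)..t, f s‖ ≤ C * (|t| ^ (k + 1) / (k + 1)) := by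
  have key : ∀ {f : ℝ → E} {t : ℝ}, (∀ s, ‖f s‖ ≤ C * |s| ^ k) → 0 ≤ t →
      ‖∫ s in (0 : ℝ)..t, f s‖ ≤ C * (|t| ^ (k + 1) / (k + 1)) := by
    intro f t hf ht
    have h1 : ‖∫ s in (0 : ℝ)..t, f s‖ ≤ ∫ s in (0 : ℝ)..t, C * s ^ k := by
      refine intervalIntegral.norm_integral_le_of_norm_le ht
        (MeasureTheory.ae_of_all _ fun s hs => ?_)
        (Continuous.intervalIntegrable (by fun_prop) _ _)
      simpa [abs_of_pos hs.1] using hf s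
    rw [intervalIntegral.integral_const_mul, integral_pow] at h1
    simpa [abs_of_nonneg ht] using h1
  rcases le_total 0 t with ht | ht
  · exact key hf ht
  · have h1 := key (f := fun s => f (-s)) (t := -t) (fun s => by simpa using hf (-s))
      (neg_nonneg.2 ht)
    rw [intervalIntegral.integral_comp_neg, neg_neg, neg_zero, intervalIntegral.integral_symm,
      norm_neg, abs_neg] at h1
    exact h1

/-- The terms of the Dyson series of the linear equation `f' = A f`, `f 0 = x₀`. -/
noncomputable def dysonTerm (A : ℝ → E →L[ℝ] E) (x₀ : E) : ℕ → ℝ → E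
  | 0 => fun _ => x₀
  | k + 1 => fun t => ∫ s in (0 : ℝ)..t, A s (dysonTerm A x₀ k s)

theorem norm_dysonTerm_le {A : ℝ → E →L[ℝ] E} {L : ℝ} (hL : ∀ t, ‖A t‖ ≤ L) (x₀ : E) (k : ℕ)
    (t : ℝ) : ‖dysonTerm A x₀ k t‖ ≤ L ^ k / k.factorial * ‖x₀‖ * |t| ^ k := by
  have hL0 : 0 ≤ L := (norm_nonneg _).trans (hL 0)
  induction k generalizing t with
  | zero => simp [dysonTerm]
  | succ k ih =>
    have h1 : ∀ s, ‖A s (dysonTerm A x₀ k s)‖ ≤ (L * (L ^ k / k.factorial * ‖x₀‖)) * |s| ^ k := by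
      intro s
      calc ‖A s (dysonTerm A x₀ k s)‖ ≤ ‖A s‖ * ‖dysonTerm A x₀ k s‖ := (A s).le_opNorm _
        _ ≤ L * (L ^ k / k.factorial * ‖x₀‖ * |s| ^ k) :=
          mul_le_mul (hL s) (ih s) (norm_nonneg _) hL0
        _ = _ := by ring
    refine (norm_integral_le_of_norm_le_mul_pow h1 t).trans (le_of_eq ?_)
    rw [Nat.factorial_succ]
    push_cast
    field_simp
    ring

variable [CompleteSpace E]

theorem hasDerivAt_dysonTerm {A : ℝ → E →L[ℝ] E} (hA : Continuous A) (x₀ : E) (k : ℕ) :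
    Continuous (dysonTerm A x₀ k) ∧
      ∀ t, HasDerivAt (dysonTerm A x₀ (k + 1)) (A t (dysonTerm A x₀ k t)) t := by
  have hd : ∀ k, Continuous (dysonTerm A x₀ k) →
      ∀ t, HasDerivAt (dysonTerm A x₀ (k + 1)) (A t (dysonTerm A x₀ k t)) t := by
    intro k hk t
    have hc : Continuous fun s => A s (dysonTerm A x₀ k s) := hA.clm_apply hk
    exact (hc.integral_hasStrictDerivAt 0 t).hasDerivAt
  have hc : ∀ k, Continuous (dysonTerm A x₀ k) := by
    intro k
    induction k with
    | zero => exact continuous_const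
    | succ k ih => exact continuous_iff_continuousAt.2 fun t => (hd k ih t).continuousAt
  exact ⟨hc k, hd k (hc k)⟩

/-- Global existence for linear equations with bounded continuous coefficients. -/
theorem exists_hasDerivAt_linear {A : ℝ → E →L[ℝ] E} (hA : Continuous A) {L : ℝ}
    (hL : ∀ t, ‖A t‖ ≤ L) (x₀ : E) :
    ∃ f : ℝ → E, f 0 = x₀ ∧ ∀ t, HasDerivAt f (A t (f t)) t := by
  have hL0 : 0 ≤ L := (norm_nonneg _).trans (hL 0)
  have hsum : ∀ T : ℝ, Summable fun k : ℕ => L ^ k / k.factorial * ‖x₀‖ * T ^ k := by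
    intro T
    refine ((Real.summable_pow_div_factorial (L * T)).mul_right ‖x₀‖).congr fun k => ?_
    rw [mul_pow]; ring
  have hs : ∀ t, Summable fun k => dysonTerm A x₀ k t := fun t =>
    Summable.of_norm_bounded (hsum |t|) fun k => norm_dysonTerm_le hL x₀ k t
  have h0 : ∀ k, dysonTerm A x₀ (k + 1) 0 = 0 := fun k => by simp [dysonTerm]
  refine ⟨fun t => x₀ + ∑' k, dysonTerm A x₀ (k + 1) t, ?_, fun t => ?_⟩
  · simp [h0]
  · have h1 : HasDerivAt (fun t => ∑' k, dysonTerm A x₀ (k + 1) t)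
        (∑' k, A t (dysonTerm A x₀ k t)) t := by
      refine hasDerivAt_tsum_of_isPreconnected
        (g' := fun k s => A s (dysonTerm A x₀ k s)) ((hsum (|t| + 1)).mul_left L)
        (t := Metric.ball (0 : ℝ) (|t| + 1)) Metric.isOpen_ball
        (convex_ball _ _).isPreconnected (y₀ := 0)
        (fun k s _ => (hasDerivAt_dysonTerm hA x₀ k).2 s) (fun k s hs => ?_)
        (Metric.mem_ball_self (by positivity)) (by simp [h0]) (by simp)
      have hs' : |s| ≤ |t| + 1 := le_of_lt (by simpa using hs)
      calc ‖A s (dysonTerm A x₀ k s)‖ ≤ ‖A s‖ * ‖dysonTerm A x₀ k s‖ := (A s).le_opNorm _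
        _ ≤ L * (L ^ k / k.factorial * ‖x₀‖ * |s| ^ k) :=
          mul_le_mul (hL s) (norm_dysonTerm_le hL x₀ k s) (norm_nonneg _) hL0
        _ ≤ _ := by gcongr
    -- Differentiation lowers the index by one, so the differentiated series is `A t` applied to the
    -- full series.
    have h2 : ∑' k, A t (dysonTerm A x₀ k t) =
        A t (x₀ + ∑' k, dysonTerm A x₀ (k + 1) t) := by
      rw [← (A t).map_tsum (hs t), (hs t).tsum_eq_zero_add]
      rfl
    rw [← h2]
    exact h1.const_add x₀

end LinearODE

/-! ### The fundamental matrix and continuity of the discriminant -/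

section Hill

/-- The first order vector field of Hill's equation. -/
noncomputable def hillField (Q : ℝ → ℂ) (μ : ℂ) (t : ℝ) (y : Fin 2 → ℂ) : Fin 2 → ℂ :=
  ![y 1, (μ - Q t) * y 0]

theorem exists_hillField_solution {Q : ℝ → ℂ} (hQ : Continuous Q) {C : ℝ} (hC : ∀ t, ‖Q t‖ ≤ C)
    (μ : ℂ) (x₀ : Fin 2 → ℂ) :
    ∃ f : ℝ → Fin 2 → ℂ, f 0 = x₀ ∧ ∀ t, HasDerivAt f (hillField Q μ t (f t)) t := by
  let B₀ : (Fin 2 → ℂ) →L[ℝ] (Fin 2 → ℂ) :=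
    (Matrix.toLin' (!![0, 1; 0, 0] : Matrix (Fin 2) (Fin 2) ℂ)).toContinuousLinearMap.restrictScalars ℝ
  let B₁ : (Fin 2 → ℂ) →L[ℝ] (Fin 2 → ℂ) :=
    (Matrix.toLin' (!![0, 0; 1, 0] : Matrix (Fin 2) (Fin 2) ℂ)).toContinuousLinearMap.restrictScalars ℝ
  have h1 : ∀ t y, (B₀ + (μ - Q t) • B₁) y = hillField Q μ t y := by
    intro t y
    ext i
    fin_cases i <;> simp [B₀, B₁, hillField, Matrix.toLin'_apply, dotProduct,
      Fin.sum_univ_two]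
  obtain ⟨f, hf0, hf⟩ := exists_hasDerivAt_linear (A := fun t => B₀ + (μ - Q t) • B₁)
    (by fun_prop) (L := ‖B₀‖ + (‖μ‖ + C) * ‖B₁‖) (fun t => by
      refine (norm_add_le _ _).trans ?_
      rw [norm_smul]
      have := (norm_sub_le μ (Q t)).trans (by gcongr; exact hC t : ‖μ‖ + ‖Q t‖ ≤ ‖μ‖ + C)
      gcongr) x₀
  exact ⟨f, hf0, fun t => h1 t (f t) ▸ hf t⟩

/-- A bound m on ‖μ‖ appears instead of ‖μ‖ itself, so that one Lipschitz constant serves a whole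
neighbourhood in the continuity proof below. -/
theorem lipschitzWith_hillField {Q : ℝ → ℂ} {C : ℝ} (hC : ∀ t, ‖Q t‖ ≤ C) {μ : ℂ} {m : ℝ}
    (hm : ‖μ‖ ≤ m) (t : ℝ) : LipschitzWith (Real.toNNReal (1 + m + C)) (hillField Q μ t) := by
  have hC0 : 0 ≤ C := (norm_nonneg _).trans (hC 0)
  have hm0 : 0 ≤ m := (norm_nonneg _).trans hm
  refine LipschitzWith.of_dist_le_mul fun x y => ?_
  rw [Real.coe_toNNReal _ (by positivity), dist_pi_le_iff (by positivity)]
  have h0 := dist_le_pi_dist x y 0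
  have h1 := dist_le_pi_dist x y 1
  have hd := dist_nonneg (x := x) (y := y)
  intro i
  fin_cases i
  · simp only [hillField, Fin.zero_eta, Matrix.cons_val_zero]
    nlinarith
  · simp only [hillField, Fin.mk_one, Matrix.cons_val_one, Matrix.cons_val_fin_one]
    rw [dist_eq_norm, ← mul_sub, norm_mul, ← dist_eq_norm (x 0)]
    have h2 : ‖μ - Q t‖ ≤ 1 + m + C := (norm_sub_le _ _).trans (by linarith [hC t])
    exact mul_le_mul h2 h0 dist_nonneg (by positivity)

theorem isPrincipalFundamentalMatrix_iff {Q : ℝ → ℂ} {μ : ℂ} {M : ℝ → Matrix (Fin 2) (Fin 2) ℂ} :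
    IsPrincipalFundamentalMatrix Q μ M ↔ M 0 = 1 ∧ ∀ (j : Fin 2) (t : ℝ),
      HasDerivAt (fun t i => M t i j) (hillField Q μ t fun i => M t i j) t := by
  refine and_congr_right fun _ => ?_
  have h : ∀ (t : ℝ) (i j : Fin 2), (hillSystemMatrix Q μ t * M t) i j =
      hillField Q μ t (fun i => M t i j) i := by
    intro t i j
    fin_cases i <;> simp [hillSystemMatrix, hillField, Matrix.mul_apply, Fin.sum_univ_two]
  simp only [h]
  constructor
  · intro H j t
    exact hasDerivAt_pi.2 fun i => H t i j
  · intro H t i j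
    exact hasDerivAt_pi.1 (H j t) i

theorem existsUnique_isPrincipalFundamentalMatrix {Q : ℝ → ℂ} (hQ : Continuous Q) {C : ℝ}
    (hC : ∀ t, ‖Q t‖ ≤ C) (μ : ℂ) :
    ∃! M : ℝ → Matrix (Fin 2) (Fin 2) ℂ, IsPrincipalFundamentalMatrix Q μ M := by
  choose f hf0 hf using fun j : Fin 2 =>
    exists_hillField_solution hQ hC μ fun i => (1 : Matrix (Fin 2) (Fin 2) ℂ) i j
  refine ⟨fun t => Matrix.of fun i j => f j t i, ?_, ?_⟩
  · refine isPrincipalFundamentalMatrix_iff.2 ⟨?_, fun j t => hf j t⟩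
    ext i j
    exact congrFun (hf0 j) i
  · intro M hM
    obtain ⟨hM0, hM'⟩ := isPrincipalFundamentalMatrix_iff.1 hM
    funext t
    ext i j
    have := ODE_solution_unique_univ (s := fun _ => Set.univ) (t₀ := 0)
      (fun t => (lipschitzWith_hillField hC (le_refl ‖μ‖) t).lipschitzOnWith)
      (fun t => ⟨hM' j t, Set.mem_univ _⟩) (fun t => ⟨hf j t, Set.mem_univ _⟩)
      (by rw [hf0 j, hM0])
    exact congrFun (congrFun this t) i

theorem hillDiscriminant_eq {Q : ℝ → ℂ} (hQ : Continuous Q) {C : ℝ} (hC : ∀ t, ‖Q t‖ ≤ C) {μ : ℂ}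
    {M : ℝ → Matrix (Fin 2) (Fin 2) ℂ} (hM : IsPrincipalFundamentalMatrix Q μ M) :
    hillDiscriminant Q μ = (M (2 * Real.pi)).trace := by
  have h : ∃ M, IsPrincipalFundamentalMatrix Q μ M := ⟨M, hM⟩
  rw [hillDiscriminant, dif_pos h,
    (existsUnique_isPrincipalFundamentalMatrix hQ hC μ).unique h.choose_spec hM]

/-- The determinant is a Wronskian, constant because the coefficient matrix has trace zero. -/
theorem det_eq_one_of_isPrincipalFundamentalMatrix {Q : ℝ → ℂ} {μ : ℂ}
    {M : ℝ → Matrix (Fin 2) (Fin 2) ℂ} (hM : IsPrincipalFundamentalMatrix Q μ M) (t : ℝ) :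
    (M t).det = 1 := by
  obtain ⟨hM0, hM'⟩ := hM
  have h1 : ∀ t, HasDerivAt (fun t => (M t).det) 0 t := by
    intro t
    rw [funext fun t => Matrix.det_fin_two (M t)]
    refine (((hM' t 0 0).mul (hM' t 1 1)).sub ((hM' t 0 1).mul (hM' t 1 0))).congr_deriv ?_
    simp [hillSystemMatrix, Matrix.mul_apply, Fin.sum_univ_two]
    ring
  have h2 := is_const_of_deriv_eq_zero (fun t => (h1 t).differentiableAt) (fun t => (h1 t).deriv) t 0
  rw [h2, hM0, Matrix.det_one]

theorem continuous_hillDiscriminant {Q : ℝ → ℂ} (hQ : Continuous Q) {C : ℝ}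
    (hC : ∀ t, ‖Q t‖ ≤ C) : Continuous (hillDiscriminant Q) := by
  choose M hM using fun μ => (existsUnique_isPrincipalFundamentalMatrix hQ hC μ).exists
  have hM' := fun μ => isPrincipalFundamentalMatrix_iff.1 (hM μ)
  simp only [funext fun μ => hillDiscriminant_eq hQ hC (hM μ)]
  refine continuous_iff_continuousAt.2 fun μ₀ => ?_
  have hcol : ∀ j : Fin 2, Tendsto (fun μ => fun i => M μ (2 * Real.pi) i j) (𝓝 μ₀)
      (𝓝 fun i => M μ₀ (2 * Real.pi) i j) := by
    intro j
    set g : ℝ → Fin 2 → ℂ := fun t i => M μ₀ t i j with hg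
    have hgc : Continuous g := continuous_iff_continuousAt.2 fun t => ((hM' μ₀).2 j t).continuousAt
    obtain ⟨B, hB⟩ := (isCompact_Icc (a := (0 : ℝ)) (b := 2 * Real.pi)).exists_bound_of_continuousOn
      hgc.continuousOn
    have hB0 : 0 ≤ B := (norm_nonneg _).trans (hB 0 ⟨le_rfl, Real.two_pi_pos.le⟩)
    set K := Real.toNNReal (1 + (‖μ₀‖ + 1) + C) with hK
    -- A column of the solution for μ₀ is an approximate trajectory of the field for μ with error at
    -- most |μ₀ − μ| B; Gronwall's inequality then compares the columns at 2π.
    have hbound : ∀ᶠ μ in 𝓝 μ₀, dist (fun i => M μ (2 * Real.pi) i j) (g (2 * Real.pi)) ≤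
        gronwallBound 0 K (0 + ‖μ₀ - μ‖ * B) (2 * Real.pi - 0) := by
      filter_upwards [Metric.ball_mem_nhds μ₀ one_pos] with μ hμ
      have hμn : ‖μ‖ ≤ ‖μ₀‖ + 1 := by
        have h1 : ‖μ - μ₀‖ < 1 := by simpa [dist_eq_norm] using hμ
        have h2 := norm_le_norm_add_norm_sub' μ μ₀
        linarith
      refine dist_le_of_approx_trajectories_ODE (v := hillField Q μ) (K := K) (a := 0)
        (b := 2 * Real.pi) (f := fun t i => M μ t i j) (g := g)
        (f' := fun t => hillField Q μ t fun i => M μ t i j)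
        (g' := fun t => hillField Q μ₀ t (g t))
        (fun t => lipschitzWith_hillField hC hμn t)
        (fun t _ => ((hM' μ).2 j t).continuousAt.continuousWithinAt)
        (fun t _ => ((hM' μ).2 j t).hasDerivWithinAt) (fun t _ => by rw [dist_self])
        hgc.continuousOn (fun t _ => ((hM' μ₀).2 j t).hasDerivWithinAt) (fun t ht => ?_) ?_
        (2 * Real.pi) ⟨Real.two_pi_pos.le, le_rfl⟩
      · rw [dist_pi_le_iff (by positivity)]
        intro i
        fin_cases i
        · simp only [hillField, Fin.zero_eta, Matrix.cons_val_zero, dist_self]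
          positivity
        · simp only [hillField, Fin.mk_one, Matrix.cons_val_one, Matrix.cons_val_fin_one]
          rw [dist_eq_norm, ← sub_mul, sub_sub_sub_cancel_right, norm_mul]
          gcongr
          exact (norm_le_pi_norm (g t) 0).trans (hB t ⟨ht.1, ht.2.le⟩)
      · simp only [hg, (hM' μ).1, (hM' μ₀).1, dist_self, le_refl]
    refine tendsto_iff_dist_tendsto_zero.2 (squeeze_zero' (Eventually.of_forall fun _ => dist_nonneg)
      hbound ?_)
    have h1 : Continuous fun μ : ℂ => gronwallBound 0 K (0 + ‖μ₀ - μ‖ * B) (2 * Real.pi - 0) :=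
      (gronwallBound_continuous_ε 0 K (2 * Real.pi - 0)).comp (by fun_prop)
    have h2 := h1.tendsto μ₀
    simpa [gronwallBound_ε0_δ0] using h2
  simp only [ContinuousAt, Matrix.trace_fin_two]
  exact ((tendsto_pi_nhds.1 (hcol 0)) 0).add ((tendsto_pi_nhds.1 (hcol 1)) 1)

end Hill

/-! ### Floquet solutions and Hill's formula -/

section discriminant

variable {Q : ℝ → ℂ} {g : ℤ → ℂ}

/-- A continuous function with vanishing Fourier coefficients on `[0, 2π]` vanishes there. -/
theorem eq_zero_of_hillFourier_eq_zero {f : ℝ → ℂ} (hf : Continuous f)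
    (h : ∀ n, hillFourier f n = 0) {t : ℝ} (ht : t ∈ Set.Icc 0 (2 * Real.pi)) : f t = 0 := by
  have hL2 : MeasureTheory.MemLp f 2 (MeasureTheory.volume.restrict (Set.Ioc 0 (2 * Real.pi))) := by
    obtain ⟨C, hC⟩ := (isCompact_Icc (a := (0 : ℝ)) (b := 2 * Real.pi)).exists_bound_of_continuousOn
      hf.continuousOn
    refine MeasureTheory.MemLp.of_bound hf.aestronglyMeasurable C ?_
    filter_upwards [MeasureTheory.ae_restrict_mem measurableSet_Ioc] with x hx
    exact hC x (Set.Ioc_subset_Icc_self hx)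
  -- By Parseval the integral of |f|² vanishes, which continuity turns into pointwise vanishing.
  have h1 := hasSum_sq_fourierCoeffOn Real.two_pi_pos hL2
  have h2 : ∀ n, fourierCoeffOn Real.two_pi_pos f n = 0 := h
  simp only [h2, norm_zero, ne_eq, OfNat.ofNat_ne_zero, not_false_eq_true, zero_pow] at h1
  have h3 := h1.unique hasSum_zero
  rw [smul_eq_mul, mul_eq_zero, sub_zero] at h3
  have h4 := h3.resolve_left (inv_ne_zero Real.two_pi_pos.ne')
  by_contra hne
  have h5 : 0 < ∫ x in (0 : ℝ)..2 * Real.pi, ‖f x‖ ^ 2 := by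
    refine intervalIntegral.integral_pos Real.two_pi_pos (by fun_prop) (fun x _ => by positivity)
      ⟨t, ht, ?_⟩
    have := norm_pos_iff.2 hne
    positivity
  exact h5.ne' h4

/-- The generalised Fourier coefficients of a Floquet solution satisfy the Floquet system. -/
theorem hasSum_floquet_system (hg : Summable fun k => ‖g k‖)
    (hQ : ∀ η : ℝ, HasSum (fun k : ℤ => g k * Complex.exp (Complex.I * k * η)) (Q η))
    {μ ν : ℂ} {y : ℝ → Fin 2 → ℂ} (hy : ∀ t, HasDerivAt y (hillField Q μ t (y t)) t)
    (hper : y (2 * Real.pi) = Complex.exp (2 * Real.pi * ν * Complex.I) • y 0) (n : ℤ) :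
    HasSum (fun m : ℤ => g (n - m) *
      ∫ t in (0 : ℝ)..2 * Real.pi, y t 0 * Complex.exp (-(Complex.I * (m + ν) * t)))
      ((μ + (n + ν) ^ 2) *
        ∫ t in (0 : ℝ)..2 * Real.pi, y t 0 * Complex.exp (-(Complex.I * (n + ν) * t))) := by
  have hyc : Continuous y := continuous_iff_continuousAt.2 fun t => (hy t).continuousAt
  have hQc := (continuous_of_hasSum_fourier hg hQ).1
  have hy0c : Continuous fun t => y t 0 := (continuous_apply 0).comp hyc
  set φ : ℝ → ℂ := fun t => Complex.exp (-(Complex.I * (n + ν) * t)) with hφ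
  have hφc : Continuous φ := by fun_prop
  have hφ' : ∀ t, HasDerivAt φ (-(Complex.I * (n + ν)) * φ t) t := by
    intro t
    have h1 : HasDerivAt (fun t : ℝ => -(Complex.I * (n + ν) * (t : ℂ)))
        (-(Complex.I * (n + ν))) t := by
      simpa [Function.comp_def] using
        ((hasDerivAt_id (t : ℂ)).const_mul (Complex.I * (n + ν))).fun_neg.comp_ofReal
    rw [mul_comm]
    exact h1.cexp
  have h0 : ∀ t, HasDerivAt (fun t => y t 0) (y t 1) t := fun t => by
    simpa [hillField] using hasDerivAt_pi.1 (hy t) 0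
  have h1 : ∀ t, HasDerivAt (fun t => y t 1) ((μ - Q t) * y t 0) t := fun t => by
    simpa [hillField] using hasDerivAt_pi.1 (hy t) 1
  -- Two integrations by parts in one primitive. Its boundary values cancel because the multiplier
  -- times φ(2π) equals 1.
  have hW : ∀ t, HasDerivAt (fun t => y t 1 * φ t + y t 0 * (Complex.I * (n + ν) * φ t))
      ((μ + (n + ν) ^ 2) * (y t 0 * φ t) - Q t * (y t 0 * φ t)) t := by
    intro t
    refine (((h1 t).mul (hφ' t)).add ((h0 t).mul ((hφ' t).const_mul _))).congr_deriv ?_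
    linear_combination (-(n + ν) ^ 2 * (y t 0 * φ t)) * Complex.I_sq
  have hφ2 : Complex.exp (2 * Real.pi * ν * Complex.I) * φ (2 * Real.pi) = 1 := by
    rw [hφ, ← Complex.exp_add]
    refine Complex.exp_eq_one_iff.2 ⟨-n, ?_⟩
    push_cast; ring
  have hφ0 : φ 0 = 1 := by simp [hφ]
  have hint : ∫ t in (0 : ℝ)..2 * Real.pi,
      ((μ + (n + ν) ^ 2) * (y t 0 * φ t) - Q t * (y t 0 * φ t)) = 0 := by
    rw [intervalIntegral.integral_eq_sub_of_hasDerivAt (fun t _ => hW t)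
      (Continuous.intervalIntegrable (by fun_prop) _ _), hper, hφ0]
    simp only [Pi.smul_apply, smul_eq_mul]
    linear_combination (y 0 1 + y 0 0 * (Complex.I * (n + ν))) * hφ2
  rw [intervalIntegral.integral_sub (Continuous.intervalIntegrable (by fun_prop) _ _)
    (Continuous.intervalIntegrable (by fun_prop) _ _), intervalIntegral.integral_const_mul,
    sub_eq_zero] at hint
  rw [hint]
  have h2 := hasSum_integral_fourier_mul hg hQ (f := fun t => y t 0 * φ t) (hy0c.mul hφc) 0 (2 * Real.pi)
  rw [← (Equiv.subLeft n).hasSum_iff] at h2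
  refine h2.congr_fun fun m => ?_
  simp only [Function.comp, Equiv.subLeft_apply]
  congr 1
  refine intervalIntegral.integral_congr fun t _ => ?_
  simp only [hφ]
  rw [mul_left_comm, ← Complex.exp_add]
  congr 2
  push_cast; ring

/-- The regularised Floquet determinant vanishes at the Floquet exponents. -/
theorem regularDet_eq_zero_of_floquet_solution {γ : ℤ → ℂ} {w : ℂ} (hg : Summable fun k => ‖g k‖)
    (hQ : ∀ η : ℝ, HasSum (fun k : ℤ => g k * Complex.exp (Complex.I * k * η)) (Q η))
    (hγ : ∀ k, γ k = if k = 0 then 0 else g k) {μ ν : ℂ} (hw : w ^ 2 = g 0 - μ)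
    {y : ℝ → Fin 2 → ℂ} (hy : ∀ t, HasDerivAt y (hillField Q μ t (y t)) t)
    (hper : y (2 * Real.pi) = Complex.exp (2 * Real.pi * ν * Complex.I) • y 0)
    {t₀ : ℝ} (ht₀ : t₀ ∈ Set.Icc 0 (2 * Real.pi)) (hne : y t₀ 0 ≠ 0) :
    regularDet γ w ν = 0 := by
  have hγs : Summable fun k => ‖γ k‖ := by
    refine Summable.of_nonneg_of_le (fun k => norm_nonneg _) (fun k => ?_) hg
    rw [hγ]; split_ifs <;> simp
  obtain ⟨b, hb, hdom⟩ := exists_regularMatrix_dominatedBy hγs w ‖ν‖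
  set a : ℤ → ℂ := fun m =>
    ∫ t in (0 : ℝ)..2 * Real.pi, y t 0 * Complex.exp (-(Complex.I * (m + ν) * t)) with ha
  have hyc : Continuous y := continuous_iff_continuousAt.2 fun t => (hy t).continuousAt
  have hy0c : Continuous fun t => y t 0 := (continuous_apply 0).comp hyc
  have hsplit : ∀ (m : ℤ) (t : ℝ), Complex.exp (-(Complex.I * (m + ν) * t)) =
      Complex.exp (-(Complex.I * ν * t)) * Complex.exp (-(Complex.I * m * t)) := by
    intro m t
    rw [← Complex.exp_add]; congr 1; ring
  have hbd : ∀ m, ‖a m‖ ≤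
      ∫ t in (0 : ℝ)..2 * Real.pi, ‖y t 0 * Complex.exp (-(Complex.I * ν * t))‖ := by
    intro m
    refine (intervalIntegral.norm_integral_le_integral_norm Real.two_pi_pos.le).trans (le_of_eq ?_)
    refine intervalIntegral.integral_congr fun t _ => ?_
    have h1 : -(Complex.I * m * t) = ((-(m * t) : ℝ) : ℂ) * Complex.I := by push_cast; ring
    rw [hsplit, h1, norm_mul, norm_mul, norm_mul, Complex.norm_exp_ofReal_mul_I, mul_one]
  -- Otherwise y e^{−iνt} would have only zero Fourier coefficients and would vanish on the
  -- interval.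
  obtain ⟨k, hk⟩ : ∃ k, a k ≠ 0 := by
    by_contra! hall
    refine hne ?_
    have h1 := eq_zero_of_hillFourier_eq_zero
      (f := fun t => y t 0 * Complex.exp (-(Complex.I * ν * t))) (by fun_prop) (fun n => by
        rw [hillFourier_eq_integral]
        have : ∫ t in (0 : ℝ)..2 * Real.pi, y t 0 * Complex.exp (-(Complex.I * ν * t)) *
            Complex.exp (-(Complex.I * n * t)) = a n := by
          refine intervalIntegral.integral_congr fun t _ => ?_
          rw [hsplit, mul_assoc]
        rw [this, hall, mul_zero]) ht₀
    exact (mul_eq_zero.1 h1).resolve_right (Complex.exp_ne_zero _)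
  refine finsetDet_eq_zero_of_kernel (hdom ν le_rfl) hb hbd (fun n => ?_) hk
  have h1 := hasSum_floquet_system hg hQ hy hper n
  have h2 : HasSum (fun m => if m = n then (w ^ 2 - ((n : ℂ) + ν) ^ 2 - g 0) * a n else 0)
      ((w ^ 2 - ((n : ℂ) + ν) ^ 2 - g 0) * a n) := hasSum_ite_eq n _
  have h3 := (h2.add h1).mul_left (rowWeight ν n)⁻¹
  have h4 : (rowWeight ν n)⁻¹ * ((w ^ 2 - ((n : ℂ) + ν) ^ 2 - g 0) * a n +
      (μ + (n + ν) ^ 2) * a n) = 0 := by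
    rw [hw]; ring
  rw [← h4]
  refine h3.congr_fun fun m => ?_
  simp only [regularMatrix, Matrix.of_apply, hγ]
  by_cases hnm : n = m
  · subst hnm
    simp only [if_true, sub_self]
    ring
  · rw [if_neg hnm, if_neg (Ne.symm hnm), if_neg (sub_ne_zero.2 hnm)]
    ring

/-- Hill's formula for a potential with absolutely convergent Fourier series. -/
theorem hillDiscriminant_eq_two_sub {γ : ℤ → ℂ} {w : ℂ} (hg : Summable fun k => ‖g k‖)
    (hQ : ∀ η : ℝ, HasSum (fun k : ℤ => g k * Complex.exp (Complex.I * k * η)) (Q η))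
    (hγ : ∀ k, γ k = if k = 0 then 0 else g k) {μ : ℂ} (hw : w ^ 2 = g 0 - μ)
    (hne : ∀ n : ℤ, w ^ 2 ≠ (n : ℂ) ^ 2) :
    hillDiscriminant Q μ =
      2 - 4 * finsetDet (floquetMatrix γ w 0) * Complex.sin (Real.pi * w) ^ 2 := by
  have hγs : Summable fun k => ‖γ k‖ := by
    refine Summable.of_nonneg_of_le (fun k => norm_nonneg _) (fun k => ?_) hg
    rw [hγ]; split_ifs <;> simp
  obtain ⟨hQc, hQb⟩ := continuous_of_hasSum_fourier hg hQ
  obtain ⟨M, hM⟩ := (existsUnique_isPrincipalFundamentalMatrix hQc hQb μ).exists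
  obtain ⟨hM0, hM'⟩ := isPrincipalFundamentalMatrix_iff.1 hM
  have hdet := det_eq_one_of_isPrincipalFundamentalMatrix hM
  -- Cosine is surjective on ℂ, so the trace is 2 cos θ; since the determinant is 1, e^{iθ} is an
  -- eigenvalue of the monodromy matrix.
  obtain ⟨θ, hθ⟩ := Complex.cos_surjective ((M (2 * Real.pi)).trace / 2)
  have hpi : (Real.pi : ℂ) ≠ 0 := Complex.ofReal_ne_zero.2 Real.pi_ne_zero
  set ν : ℂ := θ / (2 * Real.pi) with hν
  have hθν : 2 * Real.pi * ν = θ := by rw [hν]; field_simp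
  set ρ : ℂ := Complex.exp (2 * Real.pi * ν * Complex.I) with hρ
  have hchar : ρ ^ 2 - (M (2 * Real.pi)).trace * ρ + 1 = 0 := by
    have h1 : (M (2 * Real.pi)).trace = ρ + Complex.exp (-θ * Complex.I) := by
      rw [hρ, hθν, ← Complex.two_cos, hθ]; ring
    have h2 : Complex.exp (-θ * Complex.I) * ρ = 1 := by
      rw [hρ, hθν, ← Complex.exp_add]; simp
    rw [h1]
    linear_combination -h2
  have hsing : (M (2 * Real.pi) - ρ • (1 : Matrix (Fin 2) (Fin 2) ℂ)).det = 0 := by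
    have h1 := hdet (2 * Real.pi)
    rw [Matrix.det_fin_two] at h1
    rw [Matrix.trace_fin_two] at hchar
    simp only [Matrix.det_fin_two, Matrix.sub_apply, Matrix.smul_apply, Matrix.one_apply,
      smul_eq_mul, Fin.isValue, if_true, zero_ne_one, one_ne_zero, if_false]
    linear_combination hchar + h1
  obtain ⟨v, hv0, hv⟩ := Matrix.exists_mulVec_eq_zero_iff.2 hsing
  rw [Matrix.sub_mulVec, Matrix.smul_mulVec, Matrix.one_mulVec, sub_eq_zero] at hv
  set y : ℝ → Fin 2 → ℂ := fun t => (M t).mulVec v with hy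
  have hyd : ∀ t, HasDerivAt y (hillField Q μ t (y t)) t := by
    intro t
    have h1 : y = fun t => v 0 • (fun i => M t i 0) + v 1 • (fun i => M t i 1) := by
      funext t i
      simp only [hy, Matrix.mulVec, dotProduct, Fin.sum_univ_two, Pi.add_apply, Pi.smul_apply,
        smul_eq_mul, mul_comm]
    rw [h1]
    refine (((hM' 0 t).const_smul (v 0)).add ((hM' 1 t).const_smul (v 1))).congr_deriv ?_
    funext i
    fin_cases i <;> simp [hillField] <;> ring
  have hper : y (2 * Real.pi) = ρ • y 0 := by
    simp only [hy]
    rw [hv, hM0, Matrix.one_mulVec]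
  -- If the first component vanished on the whole interval, so would its derivative at the interior
  -- point π, and the invertible M(π) would annihilate v.
  obtain ⟨t₀, ht₀, hne₀⟩ : ∃ t ∈ Set.Icc 0 (2 * Real.pi), y t 0 ≠ 0 := by
    by_contra! hall
    have h1 : y Real.pi 1 = 0 := by
      have h2 : HasDerivAt (fun t => y t 0) (y Real.pi 1) Real.pi := by
        simpa [hillField] using hasDerivAt_pi.1 (hyd Real.pi) 0
      have h3 : (fun t => y t 0) =ᶠ[𝓝 Real.pi] fun _ => 0 := by
        filter_upwards [Icc_mem_nhds Real.pi_pos (show Real.pi < 2 * Real.pi by linarith [Real.pi_pos])] with t ht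
        exact hall t ht
      exact h2.unique ((hasDerivAt_const _ _).congr_of_eventuallyEq h3)
    have h4 : (M Real.pi).mulVec v = 0 := by
      funext i
      fin_cases i
      · exact hall Real.pi ⟨Real.pi_pos.le, by linarith [Real.pi_pos]⟩
      · exact h1
    exact hv0 (Matrix.eq_zero_of_mulVec_eq_zero (by rw [hdet]; exact one_ne_zero) h4)
  have h1 := two_mul_cos_eq_of_regularDet_eq_zero hγs w ν hne
    (regularDet_eq_zero_of_floquet_solution hg hQ hγ hw hyd hper ht₀ hne₀)
  rw [← h1, hillDiscriminant_eq hQc hQb hM, hθν, hθ]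
  ring

end discriminant

/-- The displayed matrix has its columns, not its rows, divided by Λ − n². The two are conjugate by
the diagonal matrix of these numbers, so the determinants agree. -/
theorem truncatedDet_hillMatrix_one (s Λ : ℂ) (hΛ : ∀ n : ℤ, Λ ≠ (n : ℂ) ^ 2) :
    truncatedDet (hillMatrix s Λ) 1 =
      (!![1, -(Complex.I * hillKappa s * s / Λ), -(hillKappa s * s ^ 2 / (Λ - 1));
          Complex.I * hillKappa s * s / (Λ - 1), 1, -(Complex.I * hillKappa s * s / (Λ - 1));
          -(hillKappa s * s ^ 2 / (Λ - 1)), Complex.I * hillKappa s * s / Λ, 1] :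
        Matrix (Fin 3) (Fin 3) ℂ).det := by
  let e : Fin 3 → Finset.Icc (-((1 : ℕ) : ℤ)) ((1 : ℕ) : ℤ) :=
    ![⟨-1, by decide⟩, ⟨0, by decide⟩, ⟨1, by decide⟩]
  have he : Function.Bijective e := by decide
  rw [truncatedDet, ← Matrix.det_submatrix_equiv_self (Equiv.ofBijective e he)]
  have h0 : Λ ≠ 0 := by simpa using hΛ 0
  have h1 : Λ - 1 ≠ 0 := sub_ne_zero.2 (by simpa using hΛ 1)
  have hI2 : Complex.I ^ (-2 : ℤ) = -1 := by
    rw [zpow_neg, zpow_ofNat, Complex.I_sq]; norm_num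
  have hI1 : Complex.I ^ (-1 : ℤ) = -Complex.I := by
    rw [zpow_neg_one, Complex.inv_I]
  have hI3 : Complex.I ^ (2 : ℤ) = -1 := by
    rw [zpow_ofNat, Complex.I_sq]
  simp [Matrix.det_fin_three, e, hillMatrix, hillGTilde, hillG, hI1, hI2, hI3]
  ring

/-! ### Assembly and removable singularities -/

section main

theorem hillMatrix_eq_floquetMatrix {s w Λ : ℂ} (h : w ^ 2 = Λ) :
    hillMatrix s Λ = floquetMatrix (hillGTilde s) w 0 := by
  ext n m
  simp [hillMatrix, floquetMatrix, h]

theorem cpow_one_half_sq (z : ℂ) : (z ^ (1 / 2 : ℂ)) ^ 2 = z := by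
  simp [one_div]

theorem normalisedHillMatrix_eq {Q : ℝ → ℂ} {s μ Λ : ℂ} (hF : ∀ k, hillFourier Q k = hillG s k)
    (hΛ : Λ = hillG s 0 - μ) (hne : ∀ n : ℤ, Λ ≠ (n : ℂ) ^ 2) :
    normalisedHillMatrix Q μ = hillMatrix s Λ := by
  ext n m
  have h1 : hillFourierSystem Q μ n n = Λ - (n : ℂ) ^ 2 := by
    simp only [hillFourierSystem, Matrix.of_apply, hF, sub_self, if_true, hΛ]
    ring
  have h2 : Λ - (n : ℂ) ^ 2 ≠ 0 := sub_ne_zero.2 (hne n)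
  simp only [normalisedHillMatrix, Matrix.of_apply, h1, hillMatrix, hillGTilde]
  by_cases hnm : n = m
  · subst hnm
    rw [h1, div_self h2]
    simp
  · simp only [hillFourierSystem, Matrix.of_apply, hF, if_neg hnm, if_neg (sub_ne_zero.2 hnm)]
    ring

/-- For ν within distance 1 of μ, an equation a − ν = n² bounds |n|, so only finitely many points
need to be avoided. -/
theorem eventually_sub_ne_sq (a μ : ℂ) :
    ∀ᶠ ν in 𝓝[≠] μ, ∀ n : ℤ, a - ν ≠ (n : ℂ) ^ 2 := by
  set F : Set ℂ := (fun n : ℤ => a - (n : ℂ) ^ 2) '' {n : ℤ | |(n : ℝ)| ≤ ‖a‖ + ‖μ‖ + 1} with hFdef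
  have hF : F.Finite := by
    refine Set.Finite.image _ ((Set.finite_Icc (-⌈‖a‖ + ‖μ‖ + 1⌉) ⌈‖a‖ + ‖μ‖ + 1⌉).subset ?_)
    intro n hn
    have h1 : (|n| : ℝ) ≤ ⌈‖a‖ + ‖μ‖ + 1⌉ := le_trans hn (Int.le_ceil _)
    exact abs_le.1 (by exact_mod_cast h1)
  have h1 : ∀ᶠ ν in 𝓝[≠] μ, ν ∈ (F \ {μ})ᶜ :=
    mem_nhdsWithin_of_mem_nhds ((hF.subset Set.sdiff_subset).isClosed.isOpen_compl.mem_nhds (by simp))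
  filter_upwards [h1, self_mem_nhdsWithin,
    mem_nhdsWithin_of_mem_nhds (Metric.ball_mem_nhds μ one_pos)] with ν hν hne hball n hn
  refine hν ⟨⟨n, ?_, ?_⟩, hne⟩
  · have h2 : ‖ν - μ‖ < 1 := by simpa [dist_eq_norm] using hball
    have h3 : ‖(n : ℂ) ^ 2‖ ≤ ‖a‖ + ‖ν‖ := hn ▸ norm_sub_le a ν
    have h4 := norm_le_norm_add_norm_sub' ν μ
    rw [norm_pow, Complex.norm_intCast] at h3
    have h5 : |(n : ℝ)| ≤ |(n : ℝ)| ^ 2 := by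
      have : |n| ≤ |n| ^ 2 := by
        rcases eq_or_ne n 0 with rfl | h
        · simp
        · exact le_self_pow₀ (Int.one_le_abs h) two_ne_zero
      exact_mod_cast this
    change |(n : ℝ)| ≤ _
    linarith
  · simp only [← hn]
    ring

theorem mainTheorem6 (c s : ℂ)
    (hc : ∀ x : ℝ, x ∈ Set.Ico (-1 : ℝ) 0 ∪ Set.Ioc (0 : ℝ) 1 → c ≠ (x : ℂ))
    (hs0 : s ≠ 0) (hs1 : ‖s‖ ≤ 1) (hcs : c = (s + 1 / s) / 2) :
    -- the Fourier coefficients and the Fourier series of the potential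
    (∀ k : ℤ, hillFourier (hillPotential c) k = hillG s k) ∧
    (∀ η : ℝ, HasSum (fun k : ℤ => hillG s k * Complex.exp (Complex.I * (k : ℂ) * (η : ℂ)))
      (hillPotential c η)) ∧
    -- the Hill determinant of Hill's equation
    (∀ μ Λ : ℂ, Λ = hillG s 0 - μ → (∀ n : ℤ, Λ ≠ (n : ℂ) ^ 2) →
      normalisedHillMatrix (hillPotential c) μ = hillMatrix s Λ ∧
      IsHillType (hillMatrix s Λ) ∧
      Filter.Tendsto (truncatedDet (hillMatrix s Λ)) Filter.atTop (nhds (hillDet s Λ)) ∧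
      infiniteDet (normalisedHillMatrix (hillPotential c) μ) = hillDet s Λ ∧
      truncatedDet (hillMatrix s Λ) 1 =
        (!![1, -(Complex.I * hillKappa s * s / Λ), -(hillKappa s * s ^ 2 / (Λ - 1));
            Complex.I * hillKappa s * s / (Λ - 1), 1, -(Complex.I * hillKappa s * s / (Λ - 1));
            -(hillKappa s * s ^ 2 / (Λ - 1)), Complex.I * hillKappa s * s / Λ, 1] :
          Matrix (Fin 3) (Fin 3) ℂ).det) ∧
    -- Hill's discriminant
    (∀ μ : ℂ, ∃! M : ℝ → Matrix (Fin 2) (Fin 2) ℂ,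
      IsPrincipalFundamentalMatrix (hillPotential c) μ M) ∧
    (∀ μ : ℂ, (∀ n : ℤ, hillG s 0 - μ ≠ (n : ℂ) ^ 2) →
      hillDiscriminant (hillPotential c) μ = hillFormula s μ) ∧
    -- at the poles of `D` the formula holds by continuous extension
    (∀ μ : ℂ, Filter.Tendsto (hillFormula s) (nhdsWithin μ {μ}ᶜ) (nhds (hillDiscriminant (hillPotential c) μ))) := by
  have hg : Summable fun k => ‖hillG s k‖ :=
    summable_norm_hillG ((norm_lt_one_or_sq_eq_neg_one hc hs0 hs1 hcs).imp And.right And.right)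
  have hQ := hasSum_hillPotential hc hs0 hs1 hcs
  have hF := hillFourier_of_hasSum hg hQ
  obtain ⟨hQc, hQb⟩ := continuous_of_hasSum_fourier hg hQ
  have hγs : Summable fun k => ‖hillGTilde s k‖ := by
    refine Summable.of_nonneg_of_le (fun k => norm_nonneg _) (fun k => ?_) hg
    unfold hillGTilde
    split_ifs <;> simp
  have hformula : ∀ μ : ℂ, (∀ n : ℤ, hillG s 0 - μ ≠ (n : ℂ) ^ 2) →
      hillDiscriminant (hillPotential c) μ = hillFormula s μ := by
    intro μ hμ
    -- The matrix depends on the square root only through its square, so the principal branch is as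
    -- good as any other.
    have hw := cpow_one_half_sq (hillG s 0 - μ)
    rw [hillFormula, hillDet, hillMatrix_eq_floquetMatrix hw, infiniteDet_eq_finsetDet
      (floquetMatrix_dominatedBy _ 0) (summable_floquet_bound hγs _ 0)]
    exact hillDiscriminant_eq_two_sub hg hQ (fun k => rfl) hw fun n => by rw [hw]; exact hμ n
  refine ⟨hF, hQ, fun μ Λ hΛ hne => ?_, existsUnique_isPrincipalFundamentalMatrix hQc hQb, hformula,
    fun μ => ?_⟩
  · have hfl := hillMatrix_eq_floquetMatrix (s := s) (cpow_one_half_sq Λ)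
    have hdom := floquetMatrix_dominatedBy (γ := hillGTilde s) (Λ ^ (1 / 2 : ℂ)) 0
    have hsum := summable_floquet_bound hγs (Λ ^ (1 / 2 : ℂ)) 0
    rw [← hfl] at hdom
    have hnorm := normalisedHillMatrix_eq hF hΛ hne
    refine ⟨hnorm, Summable.of_nonneg_of_le (fun p => norm_nonneg _) (fun p => hdom p.1 p.2) hsum,
      ?_, by rw [hnorm, hillDet], truncatedDet_hillMatrix_one s Λ hne⟩
    rw [hillDet, infiniteDet_eq_finsetDet hdom hsum]
    exact tendsto_truncatedDet hdom hsum
  · refine (((continuous_hillDiscriminant hQc hQb).tendsto μ).mono_left nhdsWithin_le_nhds).congr' ?_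
    filter_upwards [eventually_sub_ne_sq (hillG s 0) μ] with ν hν
    exact hformula ν hν

end main
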